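/- Let $U\subset\mathbb R^2$ be a non-empty connected open set with coordinates $(t^1,t^2)$. Let $H=(h_{kl})$ be a smooth symmetric $2\times2$ matrix function on $U$, let $F_i=(f_i^1\ f_i^2)$, $i=1,2$, be smooth row-vector functions on $U$, let $q$ be a smooth nowhere zero function on $U$, and let $\Lambda\in\mathbb R$. On $U\times\mathbb R^2$, with coordinates $(t^1,t^2,z^1,z^2)$, consider the metric $$ \mathbf g=\tilde g_{ij}\,dt^i\,dt^j+h_{kl}\,(dz^k+f_i^k\,dt^i)(dz^l+f_j^l\,dt^j),\qquad \tilde{\mathbf g}=\begin{pmatrix}0&q\\ q&0\end{pmatrix} $$ (so $\det\tilde{\mathbf g}<0$). Assume that everywhere on $U$ $$ \det H>0,\qquad C_\rho:=\frac{\tilde g^{ij}(\det H)_{,i}(\det H)_{,j}}{(\det H)^2}\neq0 . $$ Put $r=\sqrt{\det H}$, let $E$ be the $2\times2$ unit matrix, let a comma denote partial differentiation, let $\ln x$ mean $\ln|x|$, and let $\mathbf R_{\mu\nu}$ be the Ricci tensor of $\mathbf g$ (with the sign for which round spheres have positive Ricci curvature). Then: 1. The $\Lambda$-vacuum Einstein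 equations $\mathbf R_{\mu\nu}-\Lambda\,\mathbf g_{\mu\nu}=0$ hold on $U\times\mathbb R^2$ if and only if there is a constant row vector $A=(a_1\ a_2)$ such that on $U$ $$ \begin{gathered} (rH_{,1}H^{-1})_{,2}+(rH_{,2}H^{-1})_{,1}=-2\Lambda qr\,E-\frac qr\,A^\top A\,H^{-1},\\ (\ln q)_{,1}=(\ln(\ln r)_{,1})_{,1}+\frac{\operatorname{tr}(H_{,1}H^{-1}H_{,1}H^{-1})}{4(\ln r)_{,1}},\\ (\ln q)_{,2}=(\ln(\ln r)_{,2})_{,2}+\frac{\operatorname{tr}(H_{,2}H^{-1}H_{,2}H^{-1})}{4(\ln r)_{,2}},\\ F_{1,2}-F_{2,1}=\frac qr\,A\,H^{-1}. \end{gathered} $$ 2. Whenever this system holds with the constant row vector $A$, one has $A=0$ if and only if the distribution $\Xi^\perp$, the $\mathbf g$-orthogonal complement of $\Xi=\langle\partial_{z^1},\partial_{z^2}\rangle$, is completely integrable. 3. The system is compatible: for every constant row vector $A$, the cross-derivative condition $(\ln q)_{,12}=(\ln q)_{,21}$ for the second and third equations is an algebraic consequence of the system and the first derivatives of its first equation.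 That is, if $H,q$ are as above and at a point $t\in U$ the first equation, its first-order partial derivatives, and the second and third equations hold, then at $t$ the $t^2$-derivative of the right-hand side of the second equation equals the $t^1$-derivative of the right-hand side of the third. 4. For every constant row vector $A$, at each point of $U$ where the first equation of the system holds, $$ r_{,12}=-\Lambda qr-\frac q{4r}\,A\,H^{-1}A^\top . $$ -/

import Mathlib

open scoped Matrix ContDiff

noncomputable section

namespace G2Metric

/-! ### Differential geometry in a coordinate domain of `ι → ℝ` -/

/-- The partial derivative `∂f/∂xⁱ` at `x`. -/
def pd {ι : Type*} [Fintype ι] [DecidableEq ι] (i : ι) (f : (ι → ℝ) → ℝ) (x : ι → ℝ) : ℝ :=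
  fderiv ℝ f x (Pi.single i 1)

/-- The entrywise partial derivative of a matrix-valued function. -/
def matPd {ι m n : Type*} [Fintype ι] [DecidableEq ι] (i : ι) (M : (ι → ℝ) → Matrix m n ℝ)
    (x : ι → ℝ) : Matrix m n ℝ :=
  Matrix.of fun k l => pd i (fun s => M s k l) x

/-- The Christoffel symbols `Γᵃ_{bc}` of the metric `g`. -/
def christoffel {ι : Type*} [Fintype ι] [DecidableEq ι] (g : (ι → ℝ) → Matrix ι ι ℝ)
    (a b c : ι) (x : ι → ℝ) : ℝ :=
  (1 / 2) * ∑ d, (g x)⁻¹ a d *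
    (pd b (fun y => g y d c) x + pd c (fun y => g y d b) x - pd d (fun y => g y b c) x)

/-- The Ricci tensor
`R_{bc} = ∂_a Γᵃ_{bc} - ∂_c Γᵃ_{ba} + Γᵃ_{ad} Γᵈ_{bc} - Γᵃ_{cd} Γᵈ_{ba}`
(positive for round spheres). -/
def ricci {ι : Type*} [Fintype ι] [DecidableEq ι] (g : (ι → ℝ) → Matrix ι ι ℝ)
    (b c : ι) (x : ι → ℝ) : ℝ :=
  ∑ a, (pd a (christoffel g a b c) x - pd c (christoffel g a b a) x
    + ∑ d, (christoffel g a a d x * christoffel g d b c x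
      - christoffel g a c d x * christoffel g d b a x))

/-- The `Λ`-vacuum Einstein equations `R_{μν} - Λ g_{μν} = 0` on `M`. -/
def IsLambdaVacuum {ι : Type*} [Fintype ι] [DecidableEq ι] (Λ : ℝ)
    (g : (ι → ℝ) → Matrix ι ι ℝ) (M : Set (ι → ℝ)) : Prop :=
  ∀ x ∈ M, ∀ μ ν, ricci g μ ν x - Λ * g x μ ν = 0

/-- A distribution on the open set `M` is completely integrable if every point of `M` has an open
neighbourhood on which the distribution is tangent to the level sets of a smooth submersion. -/
def IsCompletelyIntegrable {ι : Type*} [Fintype ι]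
    (M : Set (ι → ℝ)) (D : (ι → ℝ) → Submodule ℝ (ι → ℝ)) : Prop :=
  ∀ p ∈ M, ∃ V : Set (ι → ℝ), IsOpen V ∧ p ∈ V ∧ V ⊆ M ∧
    ∃ (m : ℕ) (y : (ι → ℝ) → (Fin m → ℝ)), ContDiffOn ℝ ∞ y V ∧
      ∀ x ∈ V, Function.Surjective (fderiv ℝ y x) ∧
        D x = LinearMap.ker (fderiv ℝ y x : (ι → ℝ) →ₗ[ℝ] (Fin m → ℝ))

/-! ### Metrics with two commuting Killing fields

The adapted coordinates are indexed by `Fin 2 ⊕ Fin 2`: the index `Sum.inl i` stands for `tⁱ` and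
`Sum.inr k` for `zᵏ` (indices `0, 1` in place of `1, 2`). -/

/-- The projection `(t, z) ↦ t` onto the orbit space. -/
def proj (x : Fin 2 ⊕ Fin 2 → ℝ) : Fin 2 → ℝ := fun i => x (Sum.inl i)

/-- The metric
`g = g̃_{ij} dtⁱ dtʲ + h_{kl} (dzᵏ + f_iᵏ dtⁱ) (dzˡ + f_jˡ dtʲ)`, where `F t i k = f_iᵏ(t)`. -/
def metric (gt H F : (Fin 2 → ℝ) → Matrix (Fin 2) (Fin 2) ℝ) (x : Fin 2 ⊕ Fin 2 → ℝ) :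
    Matrix (Fin 2 ⊕ Fin 2) (Fin 2 ⊕ Fin 2) ℝ :=
  Matrix.fromBlocks
    (gt (proj x) + F (proj x) * H (proj x) * (F (proj x))ᵀ) (F (proj x) * H (proj x))
    (F (proj x) * H (proj x))ᵀ (H (proj x))

/-- The tangent space `Ξ` of the Killing leaves, spanned by `∂/∂z¹, ∂/∂z²`. -/
def killingSpan : Submodule ℝ (Fin 2 ⊕ Fin 2 → ℝ) :=
  Submodule.span ℝ (Set.range fun k : Fin 2 => Pi.single (Sum.inr k) 1)

/-- The distribution `Ξ^⊥`, orthogonal to the Killing leaves with respect to `g`. -/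
def orthDistribution (g : (Fin 2 ⊕ Fin 2 → ℝ) → Matrix (Fin 2 ⊕ Fin 2) (Fin 2 ⊕ Fin 2) ℝ)
    (x : Fin 2 ⊕ Fin 2 → ℝ) : Submodule ℝ (Fin 2 ⊕ Fin 2 → ℝ) :=
  (Matrix.toBilin' (g x)).orthogonal killingSpan

/-- The invariant `C_ρ = g̃^{ij} (det H)_{,i} (det H)_{,j} / (det H)²`. -/
def cRho (gt H : (Fin 2 → ℝ) → Matrix (Fin 2) (Fin 2) ℝ) (t : Fin 2 → ℝ) : ℝ :=
  1 / (H t).det ^ 2 * ∑ i, ∑ j,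
    pd i (fun s => (H s).det) t * pd j (fun s => (H s).det) t * (gt t)⁻¹ i j

/-- The orbit metric in null form. -/
def nullForm (q : (Fin 2 → ℝ) → ℝ) (t : Fin 2 → ℝ) : Matrix (Fin 2) (Fin 2) ℝ :=
  !![0, q t; q t, 0]

/-! ### The reduced system -/

/-- `r = √(det H)`. -/
def rad (H : (Fin 2 → ℝ) → Matrix (Fin 2) (Fin 2) ℝ) (t : Fin 2 → ℝ) : ℝ := √(H t).det

/-- The matrix `(r H_{,1} H⁻¹)_{,2} + (r H_{,2} H⁻¹)_{,1} + 2 Λ q r E + (q / r) Aᵀ A H⁻¹`. -/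
def matrixResidual (Λ : ℝ) (H : (Fin 2 → ℝ) → Matrix (Fin 2) (Fin 2) ℝ) (q : (Fin 2 → ℝ) → ℝ)
    (A : Fin 2 → ℝ) (t : Fin 2 → ℝ) : Matrix (Fin 2) (Fin 2) ℝ :=
  matPd 1 (fun s => rad H s • (matPd 0 H s * (H s)⁻¹)) t
    + matPd 0 (fun s => rad H s • (matPd 1 H s * (H s)⁻¹)) t
    + (2 * Λ * q t * rad H t) • (1 : Matrix (Fin 2) (Fin 2) ℝ)
    + (q t / rad H t) • (Matrix.vecMulVec A A * (H t)⁻¹)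

/-- The matrix equation at the point `t`. -/
def MatrixEq (Λ : ℝ) (H : (Fin 2 → ℝ) → Matrix (Fin 2) (Fin 2) ℝ) (q : (Fin 2 → ℝ) → ℝ)
    (A : Fin 2 → ℝ) (t : Fin 2 → ℝ) : Prop :=
  matPd 1 (fun s => rad H s • (matPd 0 H s * (H s)⁻¹)) t
      + matPd 0 (fun s => rad H s • (matPd 1 H s * (H s)⁻¹)) t
    = -((2 * Λ * q t * rad H t) • (1 : Matrix (Fin 2) (Fin 2) ℝ))
      - (q t / rad H t) • (Matrix.vecMulVec A A * (H t)⁻¹)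

/-- The right-hand side `(ln (ln r)_{,i})_{,i} + tr (H_{,i} H⁻¹ H_{,i} H⁻¹) / (4 (ln r)_{,i})` of
the scalar equation for `(ln q)_{,i}`. Note that `Real.log x = ln |x|` for `x ≠ 0`. -/
def scalarRhs (H : (Fin 2 → ℝ) → Matrix (Fin 2) (Fin 2) ℝ) (i : Fin 2) (t : Fin 2 → ℝ) : ℝ :=
  pd i (fun s => Real.log (pd i (fun u => Real.log (rad H u)) s)) t
    + (matPd i H t * (H t)⁻¹ * matPd i H t * (H t)⁻¹).trace
      / (4 * pd i (fun u => Real.log (rad H u)) t)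

/-- The scalar equation for `(ln q)_{,i}` at the point `t`. -/
def ScalarEq (H : (Fin 2 → ℝ) → Matrix (Fin 2) (Fin 2) ℝ) (q : (Fin 2 → ℝ) → ℝ)
    (i : Fin 2) (t : Fin 2 → ℝ) : Prop :=
  pd i (fun s => Real.log (q s)) t = scalarRhs H i t

/-- The equation `F_{1,2} - F_{2,1} = (q / r) A H⁻¹` between row vectors at the point `t`. -/
def TwistEq (H F : (Fin 2 → ℝ) → Matrix (Fin 2) (Fin 2) ℝ) (q : (Fin 2 → ℝ) → ℝ)
    (A : Fin 2 → ℝ) (t : Fin 2 → ℝ) : Prop :=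
  (fun k => pd 1 (fun s => F s 0 k) t - pd 0 (fun s => F s 1 k) t)
    = (q t / rad H t) • (A ᵥ* (H t)⁻¹)

/-- The full system of matrix and scalar equations on `U`, with constant row vector `A`. -/
def ReducedSystem (Λ : ℝ) (H F : (Fin 2 → ℝ) → Matrix (Fin 2) (Fin 2) ℝ)
    (q : (Fin 2 → ℝ) → ℝ) (A : Fin 2 → ℝ) (U : Set (Fin 2 → ℝ)) : Prop :=
  ∀ t ∈ U, MatrixEq Λ H q A t ∧ ScalarEq H q 0 t ∧ ScalarEq H q 1 t ∧ TwistEq H F q A t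

/-- Compatibility of the system at the point `t`. The system can be solved for the leading
derivatives `H_{,12}`, `q_{,1}`, `q_{,2}`, `F_{1,2}`, so its only integrability condition is the
equality of the two values of `(ln q)_{,12}` obtained by differentiating the two scalar equations.
This equality has to be an algebraic consequence, at the single point `t`, of the matrix equation,
its first derivatives, and the two scalar equations; the scalar equations are not assumed at other
points, so that the symmetry of second derivatives of `q` does not give it for free. -/
def CompatibleAt (Λ : ℝ) (H : (Fin 2 → ℝ) → Matrix (Fin 2) (Fin 2) ℝ)
    (q : (Fin 2 → ℝ) → ℝ) (A : Fin 2 → ℝ) (t : Fin 2 → ℝ) : Prop :=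
  MatrixEq Λ H q A t → (∀ i, matPd i (matrixResidual Λ H q A) t = 0) →
    ScalarEq H q 0 t → ScalarEq H q 1 t → pd 1 (scalarRhs H 0) t = pd 0 (scalarRhs H 1) t

end G2Metric

end

open Filter Topology
set_option linter.unusedSectionVars false

namespace G2Metric

/-! ### Calculus of coordinate partial derivatives. -/

section PartialDerivatives

variable {ι : Type*} [Fintype ι] [DecidableEq ι] {i j : ι} {f g : (ι → ℝ) → ℝ} {x : ι → ℝ}
  {U : Set (ι → ℝ)}

/-! The coefficients of the metric depend on `t` only, so a linear shear `z ↦ z + Cᵀ t` merely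
replaces `F` by `F + C`. Choosing `C` from the value of `F` at a given point makes the metric block
diagonal there. Ricci is a tensor under linear coordinate changes (`ricci_linPull`), so the Einstein
equations at the point reduce to algebra in the 2-jets of `q`, `H` and `F` (`einstein_iff`), where
`F` enters only through its derivatives.

The blocks of the Ricci tensor then separate. The `tz` block is, up to a nonzero factor, the
gradient of `(r/q)(F_{1,2} - F_{2,1})H`; on a connected `U` its vanishing yields the constant row
`A` and the twist equation (`exists_twistEq_iff`). Once the twist is expressed by `A`, the `zz`
block is the matrix equation, lowered with `H` (`matrixEq_iff_jetRicci`). The component `R_ii` is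
`(ln r)_{,i}` times the defect of the `i`-th scalar equation (`scalarEq_iff`); the factor is nonzero
because `C_ρ` is proportional to the product `(det H)_{,1} (det H)_{,2}`.

What remains is `R_12`, which contains `(ln q)_{,12}`. Differentiating one scalar equation and
eliminating with the matrix equation, its trace and the derivative of that trace gives a closed
formula for `(ln q)_{,12}` (`pd_scalarRhs`). Inserted in `R_12`, the formula gives `Λq`, so this
Einstein equation is a consequence of the others (`jetRicci_mixed_of_system`). The formula is also
symmetric in the two indices, which is the compatibility statement. The trace of the matrix equation
by itself is the formula for `r_{,12}`.

For integrability, `Ξ^⊥` is the common kernel of the forms `dz^k + f_i^k dt^i`. If `A = 0` these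
forms are closed, and local primitives give the required submersion. Conversely, the bracket of the
horizontal lifts of `∂/∂t¹` and `∂/∂t²` is both vertical and, by integrability, horizontal, so it
vanishes; this says `F_{1,2} = F_{2,1}`, hence `A = 0`. -/

theorem pd_congr (h : f =ᶠ[𝓝 x] g) : pd i f x = pd i g x := by
  rw [pd, pd, h.fderiv_eq]

theorem pd_congr_on (hU : IsOpen U) (h : Set.EqOn f g U) (hx : x ∈ U) : pd i f x = pd i g x :=
  pd_congr (h.eventuallyEq_of_mem (hU.mem_nhds hx))

@[simp] theorem pd_const (c : ℝ) : pd i (fun _ : ι → ℝ => c) x = 0 := by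
  simp [pd]

theorem pd_add (hf : DifferentiableAt ℝ f x) (hg : DifferentiableAt ℝ g x) :
    pd i (fun y => f y + g y) x = pd i f x + pd i g x := by
  simp [pd, fderiv_fun_add hf hg]

theorem pd_sub (hf : DifferentiableAt ℝ f x) (hg : DifferentiableAt ℝ g x) :
    pd i (fun y => f y - g y) x = pd i f x - pd i g x := by
  simp [pd, fderiv_fun_sub hf hg]

theorem pd_mul (hf : DifferentiableAt ℝ f x) (hg : DifferentiableAt ℝ g x) :
    pd i (fun y => f y * g y) x = pd i f x * g x + f x * pd i g x := by
  simp [pd, fderiv_fun_mul hf hg]; ring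

theorem pd_const_mul (c : ℝ) (hf : DifferentiableAt ℝ f x) :
    pd i (fun y => c * f y) x = c * pd i f x := by
  simp [pd, fderiv_const_mul hf]

theorem pd_sum {κ : Type*} {s : Finset κ} {f : κ → (ι → ℝ) → ℝ}
    (hf : ∀ k ∈ s, DifferentiableAt ℝ (f k) x) :
    pd i (fun y => ∑ k ∈ s, f k y) x = ∑ k ∈ s, pd i (f k) x := by
  simp [pd, fderiv_fun_sum hf]

theorem pd_scomp {φ : ℝ → ℝ} {φ' : ℝ} (hφ : HasDerivAt φ φ' (f x)) (hf : DifferentiableAt ℝ f x) :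
    pd i (fun y => φ (f y)) x = φ' * pd i f x := by
  have := (hφ.comp_hasFDerivAt x hf.hasFDerivAt).fderiv
  simp only [pd]
  rw [show (fun y => φ (f y)) = φ ∘ f from rfl, this]
  simp

theorem pd_inv (hf : DifferentiableAt ℝ f x) (h0 : f x ≠ 0) :
    pd i (fun y => (f y)⁻¹) x = -pd i f x / f x ^ 2 := by
  rw [pd_scomp (hasDerivAt_inv h0) hf]; ring

theorem pd_div (hf : DifferentiableAt ℝ f x) (hg : DifferentiableAt ℝ g x) (h0 : g x ≠ 0) :
    pd i (fun y => f y / g y) x = (pd i f x * g x - f x * pd i g x) / g x ^ 2 := by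
  simp only [div_eq_mul_inv]
  rw [pd_mul hf (hg.fun_inv h0), pd_inv hg h0]
  field_simp
  ring

theorem pd_log (hf : DifferentiableAt ℝ f x) (h0 : f x ≠ 0) :
    pd i (fun y => Real.log (f y)) x = pd i f x / f x := by
  rw [pd_scomp (Real.hasDerivAt_log h0) hf]; ring

theorem pd_sqrt (hf : DifferentiableAt ℝ f x) (h0 : f x ≠ 0) :
    pd i (fun y => √(f y)) x = pd i f x / (2 * √(f x)) := by
  rw [pd_scomp (Real.hasDerivAt_sqrt h0) hf]; ring

theorem fderiv_eq_sum_pd (v : ι → ℝ) : fderiv ℝ f x v = ∑ k, v k * pd k f x := by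
  conv_lhs => rw [← Finset.univ_sum_single v, map_sum]
  refine Finset.sum_congr rfl fun k _ => ?_
  have : (Pi.single k (v k) : ι → ℝ) = v k • Pi.single k 1 := by
    rw [← Pi.single_smul]; simp
  rw [this, map_smul, smul_eq_mul, pd]

theorem _root_.ContDiffOn.diffAt_of_mem {n : ℕ∞ω} (hf : ContDiffOn ℝ n f U) (hn : n ≠ 0)
    (hU : IsOpen U) (hx : x ∈ U) : DifferentiableAt ℝ f x :=
  (hf.contDiffAt (hU.mem_nhds hx)).differentiableAt hn

theorem contDiffOn_pd (hU : IsOpen U) (hf : ContDiffOn ℝ ∞ f U) (i : ι) :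
    ContDiffOn ℝ ∞ (pd i f) U :=
  (hf.fderiv_of_isOpen hU (by simp)).clm_apply contDiffOn_const

theorem pd_comm (hU : IsOpen U) (hf : ContDiffOn ℝ ∞ f U) (hx : x ∈ U) :
    pd i (pd j f) x = pd j (pd i f) x := by
  have h1 : ContDiffAt ℝ ∞ f x := hf.contDiffAt (hU.mem_nhds hx)
  have hs : IsSymmSndFDerivAt ℝ f x := h1.isSymmSndFDerivAt 
    (by rw [minSmoothness_of_isRCLikeNormedField]; exact WithTop.coe_le_coe.2 (le_top : (2 : ℕ∞) ≤ ⊤))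
  have hd : DifferentiableAt ℝ (fderiv ℝ f) x :=
    ((hf.fderiv_of_isOpen hU (m := ∞) (by simp)).contDiffAt
      (hU.mem_nhds hx)).differentiableAt (by simp)
  have key : ∀ a b : ι, pd a (pd b f) x
      = fderiv ℝ (fderiv ℝ f) x (Pi.single a 1) (Pi.single b 1) := by
    intro a b
    change fderiv ℝ (fun y => fderiv ℝ f y (Pi.single b 1)) x (Pi.single a 1) = _
    rw [fderiv_clm_apply hd (by fun_prop)]
    simp
  rw [key, key, hs.eq]

theorem pd_comp_mulVec (L : Matrix ι ι ℝ) (hf : DifferentiableAt ℝ f (L *ᵥ x)) :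
    pd i (fun y => f (L *ᵥ y)) x = ∑ k, L k i * pd k f (L *ᵥ x) := by
  have h1 : HasFDerivAt (fun y => L *ᵥ y) (Matrix.toLin' L).toContinuousLinearMap x :=
    (Matrix.toLin' L).toContinuousLinearMap.hasFDerivAt
  have h2 := (hf.hasFDerivAt.comp x h1).fderiv
  rw [pd, show (fun y => f (L *ᵥ y)) = f ∘ (fun y => L *ᵥ y) from rfl, h2,
    ContinuousLinearMap.comp_apply, fderiv_eq_sum_pd]
  simp

end PartialDerivatives

/-! ### Smoothness of determinants, inverse matrices and Christoffel symbols. -/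

section Smooth

variable {ι : Type*} [Fintype ι] [DecidableEq ι] {n : Type*} [Fintype n] [DecidableEq n]
  {U : Set (ι → ℝ)} {g : (ι → ℝ) → Matrix n n ℝ}

theorem contDiffOn_det (hg : ∀ a b, ContDiffOn ℝ ∞ (fun x => g x a b) U) :
    ContDiffOn ℝ ∞ (fun x => (g x).det) U := by
  simp only [Matrix.det_apply]
  refine ContDiffOn.sum fun σ _ => ?_
  refine ContDiffOn.const_smul _ (contDiffOn_prod fun a _ => hg _ _)

/-- By Cramer's rule an entry of the inverse is a quotient of two determinants, each polynomial in
the entries of `g`. -/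
theorem contDiffOn_inv (hg : ∀ a b, ContDiffOn ℝ ∞ (fun x => g x a b) U)
    (h0 : ∀ x ∈ U, (g x).det ≠ 0) (a b : n) : ContDiffOn ℝ ∞ (fun x => (g x)⁻¹ a b) U := by
  have h1 : ∀ x, (g x)⁻¹ a b = ((g x).det)⁻¹ * ((g x).updateRow b (Pi.single a 1)).det := by
    intro x
    rw [Matrix.inv_def, Ring.inverse_eq_inv', Matrix.smul_apply, Matrix.adjugate_apply, smul_eq_mul]
  simp only [h1]
  refine ((contDiffOn_det hg).inv h0).mul (contDiffOn_det fun c d => ?_)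
  by_cases h : c = b
  · subst h; simpa using contDiffOn_const
  · simpa [Matrix.updateRow_apply, h] using hg c d

theorem contDiffOn_christoffel {g : (ι → ℝ) → Matrix ι ι ℝ} (hU : IsOpen U)
    (hg : ∀ a b, ContDiffOn ℝ ∞ (fun x => g x a b) U)
    (h0 : ∀ x ∈ U, (g x).det ≠ 0) (a b c : ι) : ContDiffOn ℝ ∞ (christoffel g a b c) U := by
  unfold christoffel
  refine contDiffOn_const.mul (ContDiffOn.sum fun d _ => (contDiffOn_inv hg h0 a d).mul ?_)
  exact ((contDiffOn_pd hU (hg d c) b).add (contDiffOn_pd hU (hg d b) c)).sub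
    (contDiffOn_pd hU (hg b c) d)

/-- Entries of the derivative of an inverse matrix. -/
theorem pd_inv_apply (hU : IsOpen U) (hg : ∀ a b, ContDiffOn ℝ ∞ (fun x => g x a b) U)
    (h0 : ∀ x ∈ U, (g x).det ≠ 0) {x : ι → ℝ} (hx : x ∈ U) (i : ι) :
    matPd i (fun y => (g y)⁻¹) x = -((g x)⁻¹ * matPd i g x * (g x)⁻¹) := by
  have hd : ∀ a b, DifferentiableAt ℝ (fun y => g y a b) x := fun a b =>
    (hg a b).diffAt_of_mem (by simp) hU hx
  have hdi : ∀ a b, DifferentiableAt ℝ (fun y => (g y)⁻¹ a b) x := fun a b =>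
    (contDiffOn_inv hg h0 a b).diffAt_of_mem (by simp) hU hx
  -- This is the derivative of `g g⁻¹ = 1`, an identity valid on all of the open set `U`.
  have h1 : matPd i g x * (g x)⁻¹ + g x * matPd i (fun y => (g y)⁻¹) x = 0 := by
    ext a b
    have : pd i (fun y => ∑ c, g y a c * (g y)⁻¹ c b) x = 0 := by
      rw [pd_congr_on hU (g := fun _ => (1 : Matrix n n ℝ) a b) ?_ hx, pd_const]
      intro y hy
      simp only
      rw [← Matrix.mul_nonsing_inv (g y) (h0 y hy).isUnit, Matrix.mul_apply]
    rw [pd_sum (fun c _ => (hd a c).fun_mul (hdi c b))] at this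
    simp only [pd_mul (hd a _) (hdi _ b), Finset.sum_add_distrib] at this
    simpa [Matrix.mul_apply, matPd] using this
  have h2 : (g x)⁻¹ * (g x * matPd i (fun y => (g y)⁻¹) x) = matPd i (fun y => (g y)⁻¹) x := by
    rw [← Matrix.mul_assoc, Matrix.nonsing_inv_mul _ (h0 x hx).isUnit, Matrix.one_mul]
  rw [← h2, eq_neg_of_add_eq_zero_right h1, Matrix.mul_neg, Matrix.mul_assoc]

end Smooth

end G2Metric

namespace G2Metric

/-! ### Tensoriality of the Ricci tensor under linear changes of coordinates. -/

section LinearChange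

variable {ι : Type*} [Fintype ι] [DecidableEq ι]

/-- The transform of a tensor with one upper and two lower indices. -/
def pull (K L : Matrix ι ι ℝ) (T : ι → ι → ι → ℝ) (a b c : ι) : ℝ :=
  ∑ a', ∑ b', ∑ c', K a a' * L b' b * L c' c * T a' b' c'

/-- A lower index transforms with `L` and an upper one with `K`, so contracting the two leaves no
trace of the coordinate change. -/
theorem dotProduct_contract {K L : Matrix ι ι ℝ} (hLK : L * K = 1) (X Y : ι → ℝ) :
    ∑ d, (∑ d', X d' * L d' d) * (∑ d', K d d' * Y d') = ∑ d, X d * Y d := by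
  change (X ᵥ* L) ⬝ᵥ (K *ᵥ Y) = X ⬝ᵥ Y
  rw [Matrix.dotProduct_mulVec, Matrix.vecMul_vecMul, hLK, Matrix.vecMul_one]

/-- The connection part `∂_e Γᵃ_{bc} + Γᵃ_{ed} Γᵈ_{bc}` of the curvature. -/
noncomputable def curvPart (g : (ι → ℝ) → Matrix ι ι ℝ) (x : ι → ℝ) (e a b c : ι) : ℝ :=
  pd e (christoffel g a b c) x + ∑ d, christoffel g a e d x * christoffel g d b c x

theorem ricci_eq_curvPart (g : (ι → ℝ) → Matrix ι ι ℝ) (x : ι → ℝ) (b c : ι) :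
    ricci g b c x = ∑ a, (curvPart g x a a b c - curvPart g x c a b a) := by
  unfold ricci curvPart
  refine Finset.sum_congr rfl fun a _ => ?_
  rw [Finset.sum_sub_distrib]
  ring

variable {g : (ι → ℝ) → Matrix ι ι ℝ} {M : Set (ι → ℝ)} {K L : Matrix ι ι ℝ} {y : ι → ℝ}

/-- The metric in the linear coordinates `y` with `x = L y`. -/
def linPull (L : Matrix ι ι ℝ) (g : (ι → ℝ) → Matrix ι ι ℝ) (y : ι → ℝ) : Matrix ι ι ℝ :=
  Lᵀ * g (L *ᵥ y) * L

theorem linPull_apply (d c : ι) :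
    linPull L g y d c = ∑ i, ∑ j, L i d * L j c * g (L *ᵥ y) i j := by
  simp only [linPull, Matrix.mul_apply, Matrix.transpose_apply, Finset.sum_mul]
  rw [Finset.sum_comm]
  exact Finset.sum_congr rfl fun i _ => Finset.sum_congr rfl fun j _ => by ring

theorem pd_linPull (hg : ∀ a b, DifferentiableAt ℝ (fun x => g x a b) (L *ᵥ y)) (b d c : ι) :
    pd b (fun y => linPull L g y d c) y
      = ∑ i, ∑ j, ∑ e, L i d * L j c * L e b * pd e (fun x => g x i j) (L *ᵥ y) := by
  have h1 : ∀ i j, DifferentiableAt ℝ (fun y => g (L *ᵥ y) i j) y := fun i j =>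
    (hg i j).comp y (f := fun y => L *ᵥ y) (Matrix.toLin' L).toContinuousLinearMap.differentiableAt
  simp only [linPull_apply]
  rw [pd_sum fun i _ => DifferentiableAt.fun_sum fun j _ => (h1 i j).const_mul _]
  refine Finset.sum_congr rfl fun i _ => ?_
  rw [pd_sum fun j _ => (h1 i j).const_mul _]
  refine Finset.sum_congr rfl fun j _ => ?_
  rw [pd_const_mul _ (h1 i j), pd_comp_mulVec L (hg i j), Finset.mul_sum]
  exact Finset.sum_congr rfl fun e _ => by ring

theorem linPull_inv (hLK : L * K = 1) : (linPull L g y)⁻¹ = K * (g (L *ᵥ y))⁻¹ * Kᵀ := by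
  have hL : L⁻¹ = K := Matrix.inv_eq_right_inv hLK
  rw [linPull, Matrix.mul_inv_rev, Matrix.mul_inv_rev, ← Matrix.transpose_nonsing_inv, hL,
    Matrix.mul_assoc]

/-- Since `L` is constant, the inhomogeneous second-derivative term of the general transformation
law is absent. -/
theorem christoffel_linPull (hLK : L * K = 1)
    (hg : ∀ a b, DifferentiableAt ℝ (fun x => g x a b) (L *ᵥ y)) (a b c : ι) :
    christoffel (linPull L g) a b c y
      = pull K L (fun a b c => christoffel g a b c (L *ᵥ y)) a b c := by
  set P : ι → ι → ι → ℝ := fun e i j => pd e (fun x => g x i j) (L *ᵥ y) with hP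
  -- The index `d` is isolated with its factor `L d' d`, and in `hG` below with `K d d'`, so that
  -- the sum over `d` is a contraction of the form required by `dotProduct_contract`.
  have hC : ∀ d, pd b (fun y => linPull L g y d c) y + pd c (fun y => linPull L g y d b) y
      - pd d (fun y => linPull L g y b c) y
      = ∑ d', (∑ b', ∑ c', L b' b * L c' c * (P b' d' c' + P c' d' b' - P d' b' c')) * L d' d := by
    intro d
    rw [pd_linPull hg, pd_linPull hg, pd_linPull hg]
    have e1 : ∑ i, ∑ j, ∑ e, L i d * L j c * L e b * pd e (fun x => g x i j) (L *ᵥ y)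
        = ∑ i, ∑ b', ∑ c', L i d * L c' c * L b' b * P b' i c' :=
      Finset.sum_congr rfl fun i _ => Finset.sum_comm
    have e3 : ∑ i, ∑ j, ∑ e, L i b * L j c * L e d * pd e (fun x => g x i j) (L *ᵥ y)
        = ∑ d', ∑ b', ∑ c', L b' b * L c' c * L d' d * P d' b' c' := by
      rw [Finset.sum_comm' (t' := Finset.univ) (s' := fun _ => Finset.univ) (by simp)]
      rw [Finset.sum_congr rfl fun j _ => Finset.sum_comm, Finset.sum_comm]
      refine Finset.sum_congr rfl fun i _ => ?_
      rw [Finset.sum_comm]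
    rw [e1, e3, ← Finset.sum_add_distrib, ← Finset.sum_sub_distrib]
    refine Finset.sum_congr rfl fun d' _ => ?_
    rw [← Finset.sum_add_distrib, ← Finset.sum_sub_distrib, Finset.sum_mul]
    refine Finset.sum_congr rfl fun b' _ => ?_
    rw [← Finset.sum_add_distrib, ← Finset.sum_sub_distrib, Finset.sum_mul]
    exact Finset.sum_congr rfl fun c' _ => by simp only [hP]; ring
  have hG : ∀ d, (linPull L g y)⁻¹ a d
      = ∑ d', K d d' * ∑ a', K a a' * (g (L *ᵥ y))⁻¹ a' d' := by
    intro d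
    rw [linPull_inv hLK, Matrix.mul_apply]
    simp only [Matrix.mul_apply, Matrix.transpose_apply]
    exact Finset.sum_congr rfl fun d' _ => by ring
  rw [christoffel, Finset.sum_congr rfl fun d _ => by rw [hC d, hG d, mul_comm],
    dotProduct_contract hLK]
  have hX : ∀ d, (∑ b', ∑ c', L b' b * L c' c * (P b' d c' + P c' d b' - P d b' c'))
        * ∑ a', K a a' * (g (L *ᵥ y))⁻¹ a' d
      = ∑ a', ∑ b', ∑ c', K a a' * L b' b * L c' c
        * ((g (L *ᵥ y))⁻¹ a' d * (P b' d c' + P c' d b' - P d b' c')) := by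
    intro d
    simp only [Finset.mul_sum, Finset.sum_mul]
    exact Finset.sum_congr rfl fun a' _ => Finset.sum_congr rfl fun b' _ =>
      Finset.sum_congr rfl fun c' _ => by ring
  rw [Finset.sum_congr rfl fun d _ => hX d, Finset.sum_comm, pull, Finset.mul_sum]
  refine Finset.sum_congr rfl fun a' _ => ?_
  rw [Finset.sum_comm, Finset.mul_sum]
  refine Finset.sum_congr rfl fun b' _ => ?_
  rw [Finset.sum_comm, Finset.mul_sum]
  refine Finset.sum_congr rfl fun c' _ => ?_
  rw [← Finset.mul_sum, christoffel]
  ring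

theorem pd_pull {T : ι → ι → ι → (ι → ℝ) → ℝ}
    (hT : ∀ a b c, DifferentiableAt ℝ (T a b c) (L *ᵥ y)) (e a b c : ι) :
    pd e (fun y => pull K L (fun a b c => T a b c (L *ᵥ y)) a b c) y
      = ∑ e', L e' e * pull K L (fun a b c => pd e' (T a b c) (L *ᵥ y)) a b c := by
  have h1 : ∀ a b c, DifferentiableAt ℝ (fun y => T a b c (L *ᵥ y)) y := fun a b c =>
    (hT a b c).comp y (f := fun y => L *ᵥ y)
      (Matrix.toLin' L).toContinuousLinearMap.differentiableAt
  unfold pull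
  rw [pd_sum fun a' _ => DifferentiableAt.fun_sum fun b' _ =>
    DifferentiableAt.fun_sum fun c' _ => (h1 a' b' c').const_mul _]
  simp only [Finset.mul_sum]
  rw [Finset.sum_comm]
  refine Finset.sum_congr rfl fun a' _ => ?_
  rw [pd_sum fun b' _ => DifferentiableAt.fun_sum fun c' _ => (h1 a' b' c').const_mul _,
    Finset.sum_comm]
  refine Finset.sum_congr rfl fun b' _ => ?_
  rw [pd_sum fun c' _ => (h1 a' b' c').const_mul _, Finset.sum_comm]
  refine Finset.sum_congr rfl fun c' _ => ?_
  rw [pd_const_mul _ (h1 a' b' c'), pd_comp_mulVec L (hT a' b' c'), Finset.mul_sum]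
  exact Finset.sum_congr rfl fun e' _ => by ring

theorem sum_pull_mul_pull (hLK : L * K = 1) (S T : ι → ι → ι → ℝ) (e a b c : ι) :
    ∑ d, pull K L S a e d * pull K L T d b c
      = ∑ e', L e' e * pull K L (fun a b c => ∑ d, S a e' d * T d b c) a b c := by
  have h1 : ∀ d, pull K L S a e d = ∑ d', (∑ e', ∑ a', K a a' * L e' e * S a' e' d') * L d' d := by
    intro d
    simp only [pull, Finset.sum_mul]
    rw [Finset.sum_comm, Finset.sum_congr rfl fun _ _ => Finset.sum_comm, Finset.sum_comm]
    exact Finset.sum_congr rfl fun _ _ => Finset.sum_congr rfl fun _ _ =>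
      Finset.sum_congr rfl fun _ _ => by ring
  have h2 : ∀ d, pull K L T d b c = ∑ d', K d d' * ∑ b', ∑ c', L b' b * L c' c * T d' b' c' := by
    intro d
    simp only [pull, Finset.mul_sum]
    exact Finset.sum_congr rfl fun _ _ => Finset.sum_congr rfl fun _ _ =>
      Finset.sum_congr rfl fun _ _ => by ring
  rw [Finset.sum_congr rfl fun d _ => by rw [h1 d, h2 d], dotProduct_contract hLK]
  have hX : ∀ d, (∑ e', ∑ a', K a a' * L e' e * S a' e' d)
        * (∑ b', ∑ c', L b' b * L c' c * T d b' c')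
      = ∑ e', ∑ a', ∑ b', ∑ c', L e' e * (K a a' * L b' b * L c' c * (S a' e' d * T d b' c')) := by
    intro d
    simp only [Finset.sum_mul]
    refine Finset.sum_congr rfl fun _ _ => Finset.sum_congr rfl fun _ _ => ?_
    simp only [Finset.mul_sum]
    exact Finset.sum_congr rfl fun _ _ => Finset.sum_congr rfl fun _ _ => by ring
  rw [Finset.sum_congr rfl fun d _ => hX d, Finset.sum_comm]
  refine Finset.sum_congr rfl fun _ _ => ?_
  rw [Finset.sum_comm, pull, Finset.mul_sum]
  refine Finset.sum_congr rfl fun _ _ => ?_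
  rw [Finset.sum_comm, Finset.mul_sum]
  refine Finset.sum_congr rfl fun _ _ => ?_
  rw [Finset.sum_comm, Finset.mul_sum]
  refine Finset.sum_congr rfl fun _ _ => ?_
  rw [← Finset.mul_sum, ← Finset.mul_sum]

/-- For linear changes the symbols and their derivatives are tensorial, so this unantisymmetrised
half of the curvature is already a tensor and can be transported alone. -/
theorem curvPart_linPull (hLK : L * K = 1) (hM : IsOpen M)
    (hg : ∀ a b, ContDiffOn ℝ ∞ (fun x => g x a b) M) (h0 : ∀ x ∈ M, (g x).det ≠ 0)
    (hy : L *ᵥ y ∈ M) (e a b c : ι) :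
    curvPart (linPull L g) y e a b c
      = ∑ e', L e' e * pull K L (curvPart g (L *ᵥ y) e') a b c := by
  have hM' : IsOpen ((fun y => L *ᵥ y) ⁻¹' M) :=
    hM.preimage (Matrix.toLin' L).toContinuousLinearMap.continuous
  have hd : ∀ y, L *ᵥ y ∈ M → ∀ a b, DifferentiableAt ℝ (fun x => g x a b) (L *ᵥ y) :=
    fun y hy a b => (hg a b).diffAt_of_mem (by simp) hM hy
  have h1 : ∀ a b c, christoffel (linPull L g) a b c y
      = pull K L (fun a b c => christoffel g a b c (L *ᵥ y)) a b c :=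
    fun a b c => christoffel_linPull hLK (hd y hy) a b c
  rw [curvPart, pd_congr_on hM' (fun z hz => christoffel_linPull hLK (hd z hz) a b c) hy,
    pd_pull fun a b c => (contDiffOn_christoffel hM hg h0 a b c).diffAt_of_mem (by simp) hM hy,
    Finset.sum_congr (s₁ := Finset.univ) (f := fun d => christoffel (linPull L g) a e d y * _) rfl
      fun d _ => by rw [h1, h1], sum_pull_mul_pull hLK, ← Finset.sum_add_distrib]
  refine Finset.sum_congr rfl fun e' _ => ?_
  rw [← mul_add]
  simp only [pull, curvPart, mul_add, Finset.sum_add_distrib]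

theorem ricci_linPull (hLK : L * K = 1) (hM : IsOpen M)
    (hg : ∀ a b, ContDiffOn ℝ ∞ (fun x => g x a b) M) (h0 : ∀ x ∈ M, (g x).det ≠ 0)
    (hy : L *ᵥ y ∈ M) (b c : ι) :
    ricci (linPull L g) b c y = ∑ b', ∑ c', L b' b * L c' c * ricci g b' c' (L *ᵥ y) := by
  -- Invariance of the trace under `L K = 1`. It is needed twice: the upper index is contracted with
  -- the derivative index in one half of Ricci and with the last lower index in the other.
  have hδ : ∀ Z : ι → ι → ℝ, ∑ a, ∑ e, ∑ a', L e a * K a a' * Z e a' = ∑ a, Z a a := by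
    intro Z
    have h : ∀ e a', ∑ a, L e a * K a a' = (1 : Matrix ι ι ℝ) e a' := fun e a' => by
      rw [← hLK, Matrix.mul_apply]
    rw [Finset.sum_comm]
    refine Finset.sum_congr rfl fun e _ => ?_
    rw [Finset.sum_comm]
    simp [← Finset.sum_mul, h, Matrix.one_apply]
  simp only [ricci_eq_curvPart, Finset.sum_sub_distrib, mul_sub]
  congr 1
  · have h1 := hδ fun e a => ∑ b', ∑ c', L b' b * L c' c * curvPart g (L *ᵥ y) e a b' c'
    have h2 : ∀ a, curvPart (linPull L g) y a a b c = ∑ e, ∑ a', L e a * K a a'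
        * ∑ b', ∑ c', L b' b * L c' c * curvPart g (L *ᵥ y) e a' b' c' := by
      intro a
      rw [curvPart_linPull hLK hM hg h0 hy]
      simp only [pull, Finset.mul_sum]
      exact Finset.sum_congr rfl fun _ _ => Finset.sum_congr rfl fun _ _ =>
        Finset.sum_congr rfl fun _ _ => Finset.sum_congr rfl fun _ _ => by ring
    rw [Finset.sum_congr rfl fun a _ => h2 a, h1, Finset.sum_comm]
    refine Finset.sum_congr rfl fun _ _ => ?_
    rw [Finset.sum_comm]
    exact Finset.sum_congr rfl fun _ _ => by rw [Finset.mul_sum]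
  · have h2 : ∀ a, curvPart (linPull L g) y c a b a = ∑ e, L e c * ∑ c', ∑ a', L c' a * K a a'
        * ∑ b', L b' b * curvPart g (L *ᵥ y) e a' b' c' := by
      intro a
      rw [curvPart_linPull hLK hM hg h0 hy]
      refine Finset.sum_congr rfl fun e _ => ?_
      congr 1
      rw [Finset.sum_comm, pull]
      refine Finset.sum_congr rfl fun a' _ => ?_
      rw [Finset.sum_comm]
      refine Finset.sum_congr rfl fun c' _ => ?_
      rw [Finset.mul_sum]
      exact Finset.sum_congr rfl fun _ _ => by ring
    rw [Finset.sum_congr rfl fun a _ => h2 a, Finset.sum_comm, Finset.sum_comm (s := Finset.univ)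
      (f := fun b' c' => L b' b * L c' c * ∑ a, curvPart g (L *ᵥ y) c' a b' a)]
    refine Finset.sum_congr rfl fun e _ => ?_
    rw [← Finset.mul_sum, hδ fun c' a' => ∑ b', L b' b * curvPart g (L *ᵥ y) e a' b' c',
      Finset.sum_comm, Finset.mul_sum]
    refine Finset.sum_congr rfl fun b' _ => ?_
    rw [← Finset.mul_sum]
    ring

end LinearChange

end G2Metric

namespace G2Metric

/-! ### The Ricci tensor as an algebraic function of the 2-jet of the metric. -/

section Jets

variable {ι : Type*} [Fintype ι] [DecidableEq ι]

/-- Twice the Christoffel symbol of the first kind, from the first derivatives of a metric. -/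
def firstKind (dg : ι → Matrix ι ι ℝ) (d b c : ι) : ℝ :=
  dg b d c + dg c d b - dg d b c

/-- The Christoffel symbols from the `1`-jet of a metric. -/
noncomputable def jetChristoffel (Gi : Matrix ι ι ℝ) (dg : ι → Matrix ι ι ℝ) (a b c : ι) : ℝ :=
  (1 / 2) * ∑ d, Gi a d * firstKind dg d b c

/-- The derivatives of the Christoffel symbols from the `2`-jet of a metric. -/
noncomputable def jetDChristoffel (Gi : Matrix ι ι ℝ) (dGi dg : ι → Matrix ι ι ℝ)
    (ddg : ι → ι → Matrix ι ι ℝ) (e a b c : ι) : ℝ :=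
  (1 / 2) * ∑ d, (dGi e a d * firstKind dg d b c + Gi a d * firstKind (ddg e) d b c)

/-- The Ricci tensor from the `2`-jet of a metric. -/
noncomputable def jetRicci (Gi : Matrix ι ι ℝ) (dGi dg : ι → Matrix ι ι ℝ)
    (ddg : ι → ι → Matrix ι ι ℝ) (b c : ι) : ℝ :=
  ∑ a, (jetDChristoffel Gi dGi dg ddg a a b c - jetDChristoffel Gi dGi dg ddg c a b a
    + ∑ d, (jetChristoffel Gi dg a a d * jetChristoffel Gi dg d b c
      - jetChristoffel Gi dg a c d * jetChristoffel Gi dg d b a))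

/-- Differentiating the inverse as `-g⁻¹ (∂g) g⁻¹` removes all analysis: from here on only the
values of `g⁻¹`, `∂g` and `∂∂g` at one point matter. -/
theorem ricci_eq_jetRicci {g : (ι → ℝ) → Matrix ι ι ℝ} {M : Set (ι → ℝ)} (hM : IsOpen M)
    (hg : ∀ a b, ContDiffOn ℝ ∞ (fun x => g x a b) M) (h0 : ∀ x ∈ M, (g x).det ≠ 0)
    {x : ι → ℝ} (hx : x ∈ M) (b c : ι) :
    ricci g b c x = jetRicci (g x)⁻¹ (fun e => -((g x)⁻¹ * matPd e g x * (g x)⁻¹))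
      (fun e => matPd e g x) (fun e f => matPd e (matPd f g) x) b c := by
  have hpd : ∀ i a b, DifferentiableAt ℝ (pd i fun x => g x a b) x := fun i a b =>
    (contDiffOn_pd hM (hg a b) i).diffAt_of_mem (by simp) hM hx
  have h1 : ∀ e a b c, pd e (christoffel g a b c) x = jetDChristoffel (g x)⁻¹
      (fun e => -((g x)⁻¹ * matPd e g x * (g x)⁻¹))
      (fun e => matPd e g x) (fun e f => matPd e (matPd f g) x) e a b c := by
    intro e a b c
    have hi : ∀ d, DifferentiableAt ℝ (fun y => (g y)⁻¹ a d) x := fun d =>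
      (contDiffOn_inv hg h0 a d).diffAt_of_mem (by simp) hM hx
    have hs : ∀ d, DifferentiableAt ℝ (fun y => pd b (fun y => g y d c) y
        + pd c (fun y => g y d b) y) x := fun d => (hpd _ _ _).fun_add (hpd _ _ _)
    have hC : ∀ d, DifferentiableAt ℝ (fun y => pd b (fun y => g y d c) y
        + pd c (fun y => g y d b) y - pd d (fun y => g y b c) y) x := fun d =>
      (hs d).fun_sub (hpd _ _ _)
    unfold christoffel
    rw [pd_const_mul _ (DifferentiableAt.fun_sum fun d _ => (hi d).fun_mul (hC d)),
      pd_sum fun d _ => (hi d).fun_mul (hC d), jetDChristoffel]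
    congr 1
    refine Finset.sum_congr rfl fun d _ => ?_
    rw [pd_mul (hi d) (hC d), pd_sub (hs d) (hpd _ _ _), pd_add (hpd _ _ _) (hpd _ _ _)]
    rw [← pd_inv_apply hM hg h0 hx e]
    rfl
  simp only [ricci, jetRicci, h1]
  rfl

end Jets

end G2Metric

/-! ### Closed form of the Ricci tensor at a point where `F = 0`. -/

namespace G2Metric

/-- The off-diagonal symmetric matrix with entry `s`. -/
def offDiag (s : ℝ) : Matrix (Fin 2) (Fin 2) ℝ := !![0, s; s, 0]

/-- The derivatives at a point of a block matrix function of `t`. -/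
def blockD (J F H : Fin 2 → Matrix (Fin 2) (Fin 2) ℝ) :
    Fin 2 ⊕ Fin 2 → Matrix (Fin 2 ⊕ Fin 2) (Fin 2 ⊕ Fin 2) ℝ :=
  Sum.elim (fun i => Matrix.fromBlocks (J i) (F i) (F i)ᵀ (H i)) 0

/-- The second-order jet at a point of the data of a metric with two commuting Killing fields,
in adapted coordinates for which `F` vanishes at the point. -/
structure KillingJet where
  q : ℝ
  dq : Fin 2 → ℝ
  ddq : Fin 2 → Fin 2 → ℝ
  H : Matrix (Fin 2) (Fin 2) ℝ
  K : Matrix (Fin 2) (Fin 2) ℝ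
  dH : Fin 2 → Matrix (Fin 2) (Fin 2) ℝ
  ddH : Fin 2 → Fin 2 → Matrix (Fin 2) (Fin 2) ℝ
  dF : Fin 2 → Matrix (Fin 2) (Fin 2) ℝ
  ddF : Fin 2 → Fin 2 → Matrix (Fin 2) (Fin 2) ℝ
  hq : q ≠ 0
  hKH : K * H = 1
  hK : K 1 0 = K 0 1
  hH : H 1 0 = H 0 1
  hdH : ∀ i, dH i 1 0 = dH i 0 1
  hddH : ∀ i j, ddH i j 1 0 = ddH i j 0 1
  hddHc : ddH 1 0 = ddH 0 1
  hddqc : ddq 1 0 = ddq 0 1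
  hddFc : ddF 1 0 = ddF 0 1

namespace KillingJet

variable (Z : KillingJet)

/-- The inverse metric. -/
noncomputable def Gi : Matrix (Fin 2 ⊕ Fin 2) (Fin 2 ⊕ Fin 2) ℝ :=
  Matrix.fromBlocks (offDiag (1 / Z.q)) 0 0 Z.K

/-- The derivatives of the inverse metric. -/
noncomputable def dGi : Fin 2 ⊕ Fin 2 → Matrix (Fin 2 ⊕ Fin 2) (Fin 2 ⊕ Fin 2) ℝ :=
  blockD (fun i => offDiag (-Z.dq i / Z.q ^ 2)) (fun i => -(offDiag (1 / Z.q) * Z.dF i))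
    (fun i => -(Z.K * Z.dH i * Z.K))

/-- The derivatives of the metric. -/
def dg : Fin 2 ⊕ Fin 2 → Matrix (Fin 2 ⊕ Fin 2) (Fin 2 ⊕ Fin 2) ℝ :=
  blockD (fun i => offDiag (Z.dq i)) (fun i => Z.dF i * Z.H) Z.dH

/-- The second derivatives of the metric. -/
def ddg : Fin 2 ⊕ Fin 2 → Fin 2 ⊕ Fin 2 → Matrix (Fin 2 ⊕ Fin 2) (Fin 2 ⊕ Fin 2) ℝ :=
  Sum.elim (fun i => blockD
    (fun j => offDiag (Z.ddq i j) + (Z.dF i * Z.H * (Z.dF j)ᵀ + Z.dF j * Z.H * (Z.dF i)ᵀ))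
    (fun j => Z.ddF i j * Z.H + (Z.dF i * Z.dH j + Z.dF j * Z.dH i)) (Z.ddH i)) 0

/-- The lowered field strength `(F_{1,2} - F_{2,1}) H`. -/
def w (k : Fin 2) : ℝ := ((Z.dF 1 0 - Z.dF 0 1) ᵥ* Z.H) k

/-- The Christoffel symbols in closed form. -/
noncomputable def chr : Fin 2 ⊕ Fin 2 → Fin 2 ⊕ Fin 2 → Fin 2 ⊕ Fin 2 → ℝ
  | .inl i, .inl j, .inl m => if i = j ∧ j = m then Z.dq i / Z.q else 0
  | .inl i, .inl j, .inr l => if i = j then ![-1, 1] i * Z.w l / (2 * Z.q) else 0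
  | .inl i, .inr l, .inl j => if i = j then ![-1, 1] i * Z.w l / (2 * Z.q) else 0
  | .inl i, .inr k, .inr l => - Z.dH (![1, 0] i) k l / (2 * Z.q)
  | .inr k, .inl i, .inl j => (Z.dF i j k + Z.dF j i k) / 2
  | .inr k, .inl i, .inr l => (Z.K k 0 * Z.dH i 0 l + Z.K k 1 * Z.dH i 1 l) / 2
  | .inr k, .inr l, .inl i => (Z.K k 0 * Z.dH i 0 l + Z.K k 1 * Z.dH i 1 l) / 2
  | .inr _, .inr _, .inr _ => 0

/-- The closed forms keep the quadratic terms of Ricci small enough for a componentwise check. -/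
theorem jetChristoffel_eq (a b c : Fin 2 ⊕ Fin 2) :
    jetChristoffel Z.Gi Z.dg a b c = Z.chr a b c := by
  have hq := Z.hq
  have hH := Z.hH
  have hd := Z.hdH
  have hKH : ∀ i j, Z.K i 0 * Z.H 0 j + Z.K i 1 * Z.H 1 j = (1 : Matrix (Fin 2) (Fin 2) ℝ) i j := by
    intro i j; rw [← Z.hKH, Matrix.mul_apply, Fin.sum_univ_two]
  have h00 : Z.K 0 0 * Z.H 0 0 + Z.K 0 1 * Z.H 0 1 = 1 := by simpa [hH] using hKH 0 0
  have h01 : Z.K 0 0 * Z.H 0 1 + Z.K 0 1 * Z.H 1 1 = 0 := by simpa [hH] using hKH 0 1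
  have h10 : Z.K 0 1 * Z.H 0 0 + Z.K 1 1 * Z.H 0 1 = 0 := by simpa [hH, Z.hK] using hKH 1 0
  have h11 : Z.K 0 1 * Z.H 0 1 + Z.K 1 1 * Z.H 1 1 = 1 := by simpa [hH, Z.hK] using hKH 1 1
  have hK := Z.hK
  -- This component is treated apart because it needs `K H = 1`: the derivative of the mixed block
  -- is `dF * H`, and `K` raises the index again.
  have hsum : ∀ i j k, jetChristoffel Z.Gi Z.dg (.inr k) (.inl i) (.inl j)
      = Z.chr (.inr k) (.inl i) (.inl j) := by
    intro i j k
    fin_cases k <;>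
      simp only [jetChristoffel, firstKind, Fintype.sum_sum_type, Fin.sum_univ_two, Gi, dg, blockD,
        Sum.elim_inl, Sum.elim_inr, Matrix.fromBlocks_apply₁₁, Matrix.fromBlocks_apply₂₁,
        Matrix.fromBlocks_apply₂₂, Matrix.zero_apply, Pi.zero_apply,
        Matrix.mul_apply, Matrix.transpose_apply, chr, Fin.zero_eta, Fin.mk_one, hH, hK]
    · linear_combination ((Z.dF i j 0 + Z.dF j i 0) / 2) * h00
        + ((Z.dF i j 1 + Z.dF j i 1) / 2) * h01
    · linear_combination ((Z.dF i j 0 + Z.dF j i 0) / 2) * h10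
        + ((Z.dF i j 1 + Z.dF j i 1) / 2) * h11
  rcases a with i | i <;> rcases b with j | j <;> rcases c with m | m
  case inr.inl.inl => exact hsum j m i
  all_goals
    simp only [jetChristoffel, firstKind, Fintype.sum_sum_type, Fin.sum_univ_two, Gi, dg, blockD,
      Sum.elim_inl, Sum.elim_inr, Matrix.fromBlocks_apply₁₁, Matrix.fromBlocks_apply₁₂,
      Matrix.fromBlocks_apply₂₁, Matrix.fromBlocks_apply₂₂, Matrix.zero_apply, Pi.zero_apply,
      Matrix.mul_apply, Matrix.transpose_apply, chr, offDiag, w, Matrix.vecMul, dotProduct]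
    fin_cases i <;> fin_cases j <;> fin_cases m <;>
      simp [hH, hd, hK] <;> field_simp <;> ring_nf

/-- The Ricci tensor with the quadratic terms in closed form. -/
theorem jetRicci_eq (b c : Fin 2 ⊕ Fin 2) :
    jetRicci Z.Gi Z.dGi Z.dg Z.ddg b c
      = ∑ a, (jetDChristoffel Z.Gi Z.dGi Z.dg Z.ddg a a b c
          - jetDChristoffel Z.Gi Z.dGi Z.dg Z.ddg c a b a)
        + ∑ a, ∑ d, (Z.chr a a d * Z.chr d b c - Z.chr a c d * Z.chr d b a) := by
  simp only [jetRicci, jetChristoffel_eq, Finset.sum_add_distrib]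

/-- This block will become the matrix equation; `F` enters it only through the square of the lowered
field strength `w`. -/
theorem jetRicci_inr_inr (k l : Fin 2) :
    jetRicci Z.Gi Z.dGi Z.dg Z.ddg (.inr k) (.inr l)
      = -(1 / (2 * Z.q)) * (2 * Z.ddH 0 1 k l - (Z.dH 0 * Z.K * Z.dH 1) k l
          - (Z.dH 1 * Z.K * Z.dH 0) k l + (Z.K * Z.dH 1).trace / 2 * Z.dH 0 k l
          + (Z.K * Z.dH 0).trace / 2 * Z.dH 1 k l)
        - 1 / (2 * Z.q ^ 2) * (Z.w k * Z.w l) := by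
  have hq := Z.hq
  have hH := Z.hH
  have hd := Z.hdH
  have hK := Z.hK
  have hdd := Z.hddH
  have hc := Z.hddHc
  have h1 : ∑ a, (jetDChristoffel Z.Gi Z.dGi Z.dg Z.ddg a a (.inr k) (.inr l)
          - jetDChristoffel Z.Gi Z.dGi Z.dg Z.ddg (.inr l) a (.inr k) a)
      = (Z.dq 0 * Z.dH 1 k l + Z.dq 1 * Z.dH 0 k l) / (2 * Z.q ^ 2) - Z.ddH 0 1 k l / Z.q := by
    simp only [jetDChristoffel, firstKind, Fintype.sum_sum_type, Fin.sum_univ_two, Gi, dGi, dg, ddg,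
      blockD, Sum.elim_inl, Sum.elim_inr, Matrix.fromBlocks_apply₁₁, Matrix.fromBlocks_apply₁₂,
      Matrix.fromBlocks_apply₂₁, Matrix.fromBlocks_apply₂₂, Matrix.zero_apply, Pi.zero_apply, 
      Matrix.transpose_apply, offDiag, hc]
    simp
    field_simp
    ring
  rw [jetRicci_eq, h1]
  simp only [Fintype.sum_sum_type, Fin.sum_univ_two, chr, Matrix.mul_apply, Matrix.trace, Matrix.diag]
  -- The quadratic terms left here contain `dF` only through `w`, so `w` can be an arbitrary
  -- covector.
  generalize Z.w = w
  fin_cases k <;> fin_cases l <;> simp [hd, hK] <;> field_simp <;> ring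

end KillingJet

end G2Metric

namespace G2Metric

@[simp] theorem offDiag_zero_zero (s : ℝ) : offDiag s 0 0 = 0 := rfl
@[simp] theorem offDiag_zero_one (s : ℝ) : offDiag s 0 1 = s := rfl
@[simp] theorem offDiag_one_zero (s : ℝ) : offDiag s 1 0 = s := rfl
@[simp] theorem offDiag_one_one (s : ℝ) : offDiag s 1 1 = 0 := rfl

namespace KillingJet

variable (Z : KillingJet)

theorem H_mul_K :
    Z.H 0 0 * Z.K 0 0 + Z.H 0 1 * Z.K 0 1 = 1 ∧ Z.H 0 0 * Z.K 0 1 + Z.H 0 1 * Z.K 1 1 = 0 ∧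
      Z.H 0 1 * Z.K 0 0 + Z.H 1 1 * Z.K 0 1 = 0 ∧ Z.H 0 1 * Z.K 0 1 + Z.H 1 1 * Z.K 1 1 = 1 := by
  have h : ∀ i j, Z.H i 0 * Z.K 0 j + Z.H i 1 * Z.K 1 j = (1 : Matrix (Fin 2) (Fin 2) ℝ) i j := by
    intro i j; rw [← mul_eq_one_comm.1 Z.hKH, Matrix.mul_apply, Fin.sum_univ_two]
  refine ⟨?_, ?_, ?_, ?_⟩
  · simpa [Z.hK] using h 0 0
  · simpa using h 0 1
  · simpa [Z.hK, Z.hH] using h 1 0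
  · simpa [Z.hH] using h 1 1

/-- The derivative of the density `(r / q) (F_{1,2} - F_{2,1}) H`, multiplied by `q / r`. -/
noncomputable def dw (e k : Fin 2) : ℝ :=
  ((Z.K * Z.dH e).trace / 2 - Z.dq e / Z.q) * Z.w k
    + (((Z.ddF e 1 0 - Z.ddF e 0 1) ᵥ* Z.H) k + ((Z.dF 1 0 - Z.dF 0 1) ᵥ* Z.dH e) k)

/-- The mixed equations are of Maxwell type: the symmetrised derivatives of `F`, which depend on the
choice of the coordinates `z`, drop out, and what is left is the gradient of the twist density. -/
theorem jetRicci_inr_inl (e k : Fin 2) :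
    jetRicci Z.Gi Z.dGi Z.dg Z.ddg (.inr k) (.inl e) = ![-1, 1] e * Z.dw e k / (2 * Z.q) := by
  have hq := Z.hq
  have hH := Z.hH
  have hd := Z.hdH
  have hK := Z.hK
  have hdd := Z.hddH
  have hc := Z.hddHc
  have hf := Z.hddFc
  obtain ⟨h00, h01, h10, h11⟩ := Z.H_mul_K
  rw [jetRicci_eq]
  simp only [jetDChristoffel, firstKind, Fintype.sum_sum_type, Fin.sum_univ_two, Gi, dGi, dg, ddg,
      blockD, Sum.elim_inl, Sum.elim_inr, Matrix.fromBlocks_apply₁₁, Matrix.fromBlocks_apply₁₂,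
      Matrix.fromBlocks_apply₂₁, Matrix.fromBlocks_apply₂₂, Matrix.zero_apply, Pi.zero_apply,
      Matrix.transpose_apply, chr, Matrix.mul_apply, Matrix.trace, Matrix.diag, dw,
      w, Matrix.vecMul, dotProduct]
  fin_cases k <;> fin_cases e <;>
    simp [hd, hdd, hK, hH, hc, hf, Matrix.mul_apply, Fin.sum_univ_two]
  -- The quadratic terms pair `w` with `K * dH`. As `w` is lowered with `H`, the relations `H K = 1`
  -- turn this into the field strength paired with `dH`; the multipliers collect exactly these
  -- products.
  · linear_combination (norm := (field_simp; ring)) (1 / (4 * Z.q))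
      * ((Z.dF 1 0 0 - Z.dF 0 1 0) * (Z.dH 0 0 0 * h00 + Z.dH 0 0 1 * h01)
        + (Z.dF 1 0 1 - Z.dF 0 1 1) * (Z.dH 0 0 0 * h10 + Z.dH 0 0 1 * h11))
  · linear_combination (norm := (field_simp; ring)) (-1 / (4 * Z.q))
      * ((Z.dF 1 0 0 - Z.dF 0 1 0) * (Z.dH 1 0 0 * h00 + Z.dH 1 0 1 * h01)
        + (Z.dF 1 0 1 - Z.dF 0 1 1) * (Z.dH 1 0 0 * h10 + Z.dH 1 0 1 * h11))
  · linear_combination (norm := (field_simp; ring)) (1 / (4 * Z.q))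
      * ((Z.dF 1 0 0 - Z.dF 0 1 0) * (Z.dH 0 0 1 * h00 + Z.dH 0 1 1 * h01)
        + (Z.dF 1 0 1 - Z.dF 0 1 1) * (Z.dH 0 0 1 * h10 + Z.dH 0 1 1 * h11))
  · linear_combination (norm := (field_simp; ring)) (-1 / (4 * Z.q))
      * ((Z.dF 1 0 0 - Z.dF 0 1 0) * (Z.dH 1 0 1 * h00 + Z.dH 1 1 1 * h01)
        + (Z.dF 1 0 1 - Z.dF 0 1 1) * (Z.dH 1 0 1 * h10 + Z.dH 1 1 1 * h11))

/-- The coordinate formula for Ricci is not visibly symmetric, so the transposed block needs its own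
computation. -/
theorem jetRicci_inl_inr (e k : Fin 2) :
    jetRicci Z.Gi Z.dGi Z.dg Z.ddg (.inl e) (.inr k) = ![-1, 1] e * Z.dw e k / (2 * Z.q) := by
  have hq := Z.hq
  have hH := Z.hH
  have hd := Z.hdH
  have hK := Z.hK
  have hdd := Z.hddH
  have hc := Z.hddHc
  have hf := Z.hddFc
  obtain ⟨h00, h01, h10, h11⟩ := Z.H_mul_K
  rw [jetRicci_eq]
  simp only [jetDChristoffel, firstKind, Fintype.sum_sum_type, Fin.sum_univ_two, Gi, dGi, dg, ddg,
      blockD, Sum.elim_inl, Sum.elim_inr, Matrix.fromBlocks_apply₁₁, Matrix.fromBlocks_apply₁₂,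
      Matrix.fromBlocks_apply₂₁, Matrix.fromBlocks_apply₂₂, Matrix.zero_apply, Pi.zero_apply,
      Matrix.transpose_apply, chr, Matrix.mul_apply, Matrix.trace, Matrix.diag, dw,
      w, Matrix.vecMul, dotProduct]
  fin_cases k <;> fin_cases e <;>
    simp [hd, hdd, hK, hH, hc, hf, Matrix.mul_apply, Fin.sum_univ_two]
  · linear_combination (norm := (field_simp; ring)) (1 / (4 * Z.q))
      * ((Z.dF 1 0 0 - Z.dF 0 1 0) * (Z.dH 0 0 0 * h00 + Z.dH 0 0 1 * h01)
        + (Z.dF 1 0 1 - Z.dF 0 1 1) * (Z.dH 0 0 0 * h10 + Z.dH 0 0 1 * h11))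
  · linear_combination (norm := (field_simp; ring)) (-1 / (4 * Z.q))
      * ((Z.dF 1 0 0 - Z.dF 0 1 0) * (Z.dH 1 0 0 * h00 + Z.dH 1 0 1 * h01)
        + (Z.dF 1 0 1 - Z.dF 0 1 1) * (Z.dH 1 0 0 * h10 + Z.dH 1 0 1 * h11))
  · linear_combination (norm := (field_simp; ring)) (1 / (4 * Z.q))
      * ((Z.dF 1 0 0 - Z.dF 0 1 0) * (Z.dH 0 0 1 * h00 + Z.dH 0 1 1 * h01)
        + (Z.dF 1 0 1 - Z.dF 0 1 1) * (Z.dH 0 0 1 * h10 + Z.dH 0 1 1 * h11))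
  · linear_combination (norm := (field_simp; ring)) (-1 / (4 * Z.q))
      * ((Z.dF 1 0 0 - Z.dF 0 1 0) * (Z.dH 1 0 1 * h00 + Z.dH 1 1 1 * h01)
        + (Z.dF 1 0 1 - Z.dF 0 1 1) * (Z.dH 1 0 1 * h10 + Z.dH 1 1 1 * h11))

/-- In null coordinates the second derivatives of `q` cancel here and `F` does not contribute. The
result is linear in `dq e / q`, and can be solved for it when the trace of `K * dH e` is nonzero. -/
theorem jetRicci_inl_self (e : Fin 2) :
    jetRicci Z.Gi Z.dGi Z.dg Z.ddg (.inl e) (.inl e)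
      = Z.dq e / Z.q * (Z.K * Z.dH e).trace / 2 - (Z.K * Z.ddH e e).trace / 2
        + (Z.K * Z.dH e * Z.K * Z.dH e).trace / 4 := by
  have hq := Z.hq
  have hH := Z.hH
  have hd := Z.hdH
  have hK := Z.hK
  have hdd := Z.hddH
  have hc := Z.hddHc
  have hf := Z.hddFc
  rw [jetRicci_eq]
  simp only [jetDChristoffel, firstKind, Fintype.sum_sum_type, Fin.sum_univ_two, Gi, dGi, dg, ddg,
      blockD, Sum.elim_inl, Sum.elim_inr, Matrix.fromBlocks_apply₁₁, Matrix.fromBlocks_apply₁₂,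
      Matrix.fromBlocks_apply₂₁, Matrix.fromBlocks_apply₂₂, Matrix.zero_apply, Pi.zero_apply,
      Matrix.transpose_apply, chr, Matrix.mul_apply, Matrix.trace, Matrix.diag,
      w, Matrix.vecMul, dotProduct]
  fin_cases e <;>
    simp [hd, hdd, hK, hH, hf, Matrix.mul_apply, Fin.sum_univ_two] <;> field_simp <;> ring

/-- The first bracket is `(ln q)_{,12}`: this is the one component with second derivatives of `q`.
-/
theorem jetRicci_inl_of_ne {i j : Fin 2} (hij : i ≠ j) :
    jetRicci Z.Gi Z.dGi Z.dg Z.ddg (.inl i) (.inl j)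
      = -(Z.ddq 0 1 / Z.q - Z.dq 0 * Z.dq 1 / Z.q ^ 2) - (Z.K * Z.ddH 0 1).trace / 2
        + (Z.K * Z.dH 0 * Z.K * Z.dH 1).trace / 4
        + (∑ k, Z.w k * (Z.dF 1 0 k - Z.dF 0 1 k)) / (2 * Z.q) := by
  have hq := Z.hq
  have hH := Z.hH
  have hd := Z.hdH
  have hK := Z.hK
  have hdd := Z.hddH
  have hc := Z.hddHc
  have hf := Z.hddFc
  have hqc := Z.hddqc
  rw [jetRicci_eq]
  simp only [jetDChristoffel, firstKind, Fintype.sum_sum_type, Fin.sum_univ_two, Gi, dGi, dg, ddg,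
      blockD, Sum.elim_inl, Sum.elim_inr, Matrix.fromBlocks_apply₁₁, Matrix.fromBlocks_apply₁₂,
      Matrix.fromBlocks_apply₂₁, Matrix.fromBlocks_apply₂₂, Matrix.zero_apply, Pi.zero_apply,
      Matrix.transpose_apply, chr, Matrix.mul_apply, Matrix.trace, Matrix.diag,
      w, Matrix.vecMul, dotProduct]
  fin_cases i <;> fin_cases j <;> first | exact absurd rfl hij | skip
  all_goals
    simp [hd, hdd, hK, hH, hqc, hc, hf, Matrix.mul_apply, Fin.sum_univ_two]
    field_simp
    ring

end KillingJet

end G2Metric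

namespace G2Metric

/-! ### Differentiation rules for matrix-valued functions. -/

section SmoothMatrices

variable {ι l m n : Type*} [Fintype ι] [DecidableEq ι] {U : Set (ι → ℝ)} {x : ι → ℝ} {i j : ι}

/-- Entrywise smoothness of a matrix-valued function. -/
def SmoothMat (U : Set (ι → ℝ)) (A : (ι → ℝ) → Matrix m n ℝ) : Prop :=
  ∀ a b, ContDiffOn ℝ ∞ (fun s => A s a b) U

theorem _root_.ContDiffOn.dAt {f : (ι → ℝ) → ℝ} (hf : ContDiffOn ℝ ∞ f U)
    (hU : IsOpen U) (hx : x ∈ U) : DifferentiableAt ℝ f x :=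
  hf.diffAt_of_mem (by simp) hU hx

theorem matPd_congr_on {A B : (ι → ℝ) → Matrix m n ℝ} (hU : IsOpen U) (h : ∀ s ∈ U, A s = B s)
    (hx : x ∈ U) : matPd i A x = matPd i B x := by
  ext a b
  exact pd_congr_on hU (fun s hs => by simp only [h s hs]) hx

@[simp] theorem matPd_const (A : Matrix m n ℝ) : matPd i (fun _ => A) x = 0 := by
  ext a b; simp [matPd]

namespace SmoothMat

theorem matPd {A : (ι → ℝ) → Matrix m n ℝ} (hA : SmoothMat U A) (hU : IsOpen U) (i : ι) :
    SmoothMat U (matPd i A) := fun a b => contDiffOn_pd hU (hA a b) i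

theorem add {A B : (ι → ℝ) → Matrix m n ℝ} (hA : SmoothMat U A) (hB : SmoothMat U B) :
    SmoothMat U (fun s => A s + B s) := fun a b => (hA a b).add (hB a b)

theorem sub {A B : (ι → ℝ) → Matrix m n ℝ} (hA : SmoothMat U A) (hB : SmoothMat U B) :
    SmoothMat U (fun s => A s - B s) := fun a b => (hA a b).sub (hB a b)

theorem const (A : Matrix m n ℝ) : SmoothMat U (fun _ => A) := fun _ _ => contDiffOn_const

theorem transpose {A : (ι → ℝ) → Matrix m n ℝ} (hA : SmoothMat U A) :
    SmoothMat U (fun s => (A s)ᵀ) := fun a b => hA b a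

theorem smul {f : (ι → ℝ) → ℝ} {A : (ι → ℝ) → Matrix m n ℝ} (hf : ContDiffOn ℝ ∞ f U)
    (hA : SmoothMat U A) : SmoothMat U (fun s => f s • A s) := fun a b => hf.mul (hA a b)

theorem mul [Fintype m] {A : (ι → ℝ) → Matrix l m ℝ} {B : (ι → ℝ) → Matrix m n ℝ}
    (hA : SmoothMat U A) (hB : SmoothMat U B) : SmoothMat U (fun s => A s * B s) := fun a b => by
  simp only [Matrix.mul_apply]
  exact ContDiffOn.sum fun c _ => (hA a c).mul (hB c b)

theorem inv [Fintype n] [DecidableEq n] {A : (ι → ℝ) → Matrix n n ℝ} (hA : SmoothMat U A)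
    (h0 : ∀ s ∈ U, (A s).det ≠ 0) : SmoothMat U (fun s => (A s)⁻¹) := contDiffOn_inv hA h0

theorem trace [Fintype n] {A : (ι → ℝ) → Matrix n n ℝ} (hA : SmoothMat U A) :
    ContDiffOn ℝ ∞ (fun s => (A s).trace) U := ContDiffOn.sum fun a _ => hA a a

end SmoothMat

theorem matPd_add (hU : IsOpen U) {A B : (ι → ℝ) → Matrix m n ℝ} (hA : SmoothMat U A)
    (hB : SmoothMat U B) (hx : x ∈ U) :
    matPd i (fun s => A s + B s) x = matPd i A x + matPd i B x := by
  ext a b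
  exact pd_add ((hA a b).dAt hU hx) ((hB a b).dAt hU hx)

theorem matPd_sub (hU : IsOpen U) {A B : (ι → ℝ) → Matrix m n ℝ} (hA : SmoothMat U A)
    (hB : SmoothMat U B) (hx : x ∈ U) :
    matPd i (fun s => A s - B s) x = matPd i A x - matPd i B x := by
  ext a b
  exact pd_sub ((hA a b).dAt hU hx) ((hB a b).dAt hU hx)

theorem matPd_smul (hU : IsOpen U) {f : (ι → ℝ) → ℝ} {A : (ι → ℝ) → Matrix m n ℝ}
    (hf : ContDiffOn ℝ ∞ f U) (hA : SmoothMat U A) (hx : x ∈ U) :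
    matPd i (fun s => f s • A s) x = pd i f x • A x + f x • matPd i A x := by
  ext a b
  exact pd_mul (hf.dAt hU hx) ((hA a b).dAt hU hx)

theorem matPd_mul [Fintype m] (hU : IsOpen U) {A : (ι → ℝ) → Matrix l m ℝ}
    {B : (ι → ℝ) → Matrix m n ℝ} (hA : SmoothMat U A) (hB : SmoothMat U B) (hx : x ∈ U) :
    matPd i (fun s => A s * B s) x = matPd i A x * B x + A x * matPd i B x := by
  ext a b
  have h : ∀ c, DifferentiableAt ℝ (fun s => A s a c) x := fun c => (hA a c).dAt hU hx
  have h' : ∀ c, DifferentiableAt ℝ (fun s => B s c b) x := fun c => (hB c b).dAt hU hx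
  simp only [matPd, Matrix.of_apply, Matrix.mul_apply, Matrix.add_apply]
  rw [pd_sum fun c _ => (h c).fun_mul (h' c), ← Finset.sum_add_distrib]
  exact Finset.sum_congr rfl fun c _ => pd_mul (h c) (h' c)

theorem matPd_transpose (A : (ι → ℝ) → Matrix m n ℝ) :
    matPd i (fun s => (A s)ᵀ) x = (matPd i A x)ᵀ := rfl

theorem matPd_inv [Fintype n] [DecidableEq n] (hU : IsOpen U) {A : (ι → ℝ) → Matrix n n ℝ}
    (hA : SmoothMat U A) (h0 : ∀ s ∈ U, (A s).det ≠ 0) (hx : x ∈ U) :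
    matPd i (fun s => (A s)⁻¹) x = -((A x)⁻¹ * matPd i A x * (A x)⁻¹) :=
  pd_inv_apply hU hA h0 hx i

theorem pd_trace [Fintype n] (hU : IsOpen U) {A : (ι → ℝ) → Matrix n n ℝ}
    (hA : SmoothMat U A) (hx : x ∈ U) :
    pd i (fun s => (A s).trace) x = (matPd i A x).trace :=
  pd_sum fun a _ => (hA a a).dAt hU hx

theorem matPd_comm (hU : IsOpen U) {A : (ι → ℝ) → Matrix m n ℝ} (hA : SmoothMat U A) (hx : x ∈ U) :
    matPd i (matPd j A) x = matPd j (matPd i A) x := by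
  ext a b
  exact pd_comm hU (hA a b) hx

end SmoothMatrices

/-! ### Derivatives of functions that depend on `t` only. -/

section Pullback

variable {U : Set (Fin 2 → ℝ)} {x : Fin 2 ⊕ Fin 2 → ℝ}

/-- `proj` as a continuous linear map. -/
noncomputable def projL : (Fin 2 ⊕ Fin 2 → ℝ) →L[ℝ] (Fin 2 → ℝ) :=
  ContinuousLinearMap.pi fun i => ContinuousLinearMap.proj (Sum.inl i)

theorem projL_apply (x : Fin 2 ⊕ Fin 2 → ℝ) : projL x = proj x := rfl

theorem isOpen_proj_preimage (hU : IsOpen U) : IsOpen {x | proj x ∈ U} :=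
  hU.preimage projL.continuous

theorem contDiffOn_comp_proj {f : (Fin 2 → ℝ) → ℝ} (hf : ContDiffOn ℝ ∞ f U) :
    ContDiffOn ℝ ∞ (fun x => f (proj x)) {x | proj x ∈ U} :=
  hf.comp projL.contDiff.contDiffOn fun _ h => h

theorem pd_inl_comp_proj {f : (Fin 2 → ℝ) → ℝ} (hf : DifferentiableAt ℝ f (proj x)) (i : Fin 2) :
    pd (Sum.inl i) (fun x => f (proj x)) x = pd i f (proj x) := by
  have h := (hf.hasFDerivAt.comp x projL.hasFDerivAt).fderiv
  rw [pd, show (fun x => f (proj x)) = f ∘ proj from rfl, h, ContinuousLinearMap.comp_apply, pd]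
  congr 1
  ext j
  simp [projL_apply, proj, Pi.single_apply]

theorem pd_inr_comp_proj {f : (Fin 2 → ℝ) → ℝ} (hf : DifferentiableAt ℝ f (proj x)) (k : Fin 2) :
    pd (Sum.inr k) (fun x => f (proj x)) x = 0 := by
  have h := (hf.hasFDerivAt.comp x projL.hasFDerivAt).fderiv
  rw [pd, show (fun x => f (proj x)) = f ∘ proj from rfl, h, ContinuousLinearMap.comp_apply]
  have : projL (Pi.single (Sum.inr k) 1) = 0 := by
    ext j
    simp [projL_apply, proj]
  rw [this, map_zero]

/-- A symmetric block matrix function of `t`, pulled back along the projection. -/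
def blockPull (A B D : (Fin 2 → ℝ) → Matrix (Fin 2) (Fin 2) ℝ) (x : Fin 2 ⊕ Fin 2 → ℝ) :
    Matrix (Fin 2 ⊕ Fin 2) (Fin 2 ⊕ Fin 2) ℝ :=
  Matrix.fromBlocks (A (proj x)) (B (proj x)) (B (proj x))ᵀ (D (proj x))

variable {A B D : (Fin 2 → ℝ) → Matrix (Fin 2) (Fin 2) ℝ}

theorem SmoothMat.blockPull (hA : SmoothMat U A) (hB : SmoothMat U B) (hD : SmoothMat U D) :
    SmoothMat {x | proj x ∈ U} (blockPull A B D) := by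
  rintro (a | a) (b | b)
  exacts [contDiffOn_comp_proj (hA a b), contDiffOn_comp_proj (hB a b),
    contDiffOn_comp_proj (hB b a), contDiffOn_comp_proj (hD a b)]

theorem matPd_blockPull (hU : IsOpen U) (hA : SmoothMat U A) (hB : SmoothMat U B)
    (hD : SmoothMat U D) (hx : proj x ∈ U) (e : Fin 2 ⊕ Fin 2) :
    matPd e (blockPull A B D) x = blockD (fun i => matPd i A (proj x)) (fun i => matPd i B (proj x))
      (fun i => matPd i D (proj x)) e := by
  rcases e with i | i
  · ext (a | a) (b | b)
    exacts [pd_inl_comp_proj ((hA a b).dAt hU hx) i, pd_inl_comp_proj ((hB a b).dAt hU hx) i,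
      pd_inl_comp_proj ((hB b a).dAt hU hx) i, pd_inl_comp_proj ((hD a b).dAt hU hx) i]
  · ext (a | a) (b | b)
    exacts [pd_inr_comp_proj ((hA a b).dAt hU hx) i, pd_inr_comp_proj ((hB a b).dAt hU hx) i,
      pd_inr_comp_proj ((hB b a).dAt hU hx) i, pd_inr_comp_proj ((hD a b).dAt hU hx) i]

theorem matPd_matPd_blockPull (hU : IsOpen U) (hA : SmoothMat U A) (hB : SmoothMat U B)
    (hD : SmoothMat U D) (hx : proj x ∈ U) (e f : Fin 2 ⊕ Fin 2) :
    matPd e (matPd f (blockPull A B D)) x = (Sum.elim (fun i => blockD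
      (fun j => matPd i (matPd j A) (proj x)) (fun j => matPd i (matPd j B) (proj x))
      (fun j => matPd i (matPd j D) (proj x))) 0 : _ → _ → Matrix _ _ ℝ) e f := by
  rw [matPd_congr_on (isOpen_proj_preimage hU) (fun s hs => matPd_blockPull hU hA hB hD hs f) hx]
  rcases f with j | j
  · change matPd e (G2Metric.blockPull (matPd j A) (matPd j B) (matPd j D)) x = _
    rw [matPd_blockPull hU (hA.matPd hU j) (hB.matPd hU j) (hD.matPd hU j) hx]
    rcases e with i | i <;> rfl
  · change matPd e (fun _ => 0) x = _
    rw [matPd_const]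
    rcases e with i | i <;> rfl

end Pullback

end G2Metric

/-! ### Reduction of the Einstein equations at a point to the case `F = 0`. -/

namespace G2Metric

theorem ricci_congr_on {ι : Type*} [Fintype ι] [DecidableEq ι] {g g' : (ι → ℝ) → Matrix ι ι ℝ}
    {M : Set (ι → ℝ)} (hM : IsOpen M) (h : ∀ x ∈ M, g x = g' x) {x : ι → ℝ} (hx : x ∈ M)
    (b c : ι) : ricci g b c x = ricci g' b c x := by
  have h1 : ∀ a b c, ∀ y ∈ M, christoffel g a b c y = christoffel g' a b c y := by
    intro a b c y hy
    have hp : ∀ i j k, pd i (fun y => g y j k) y = pd i (fun y => g' y j k) y := fun i j k =>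
      pd_congr_on hM (fun z hz => by simp only [h z hz]) hy
    simp only [christoffel, hp, h y hy]
  have h2 : ∀ e a b c, pd e (christoffel g a b c) x = pd e (christoffel g' a b c) x :=
    fun e a b c => pd_congr_on hM (h1 a b c) hx
  simp only [ricci, h2, h1 _ _ _ x hx]

/-- The matrix of the shear `(t, z) ↦ (t, z + Cᵀ t)`. -/
def shear (C : Matrix (Fin 2) (Fin 2) ℝ) : Matrix (Fin 2 ⊕ Fin 2) (Fin 2 ⊕ Fin 2) ℝ :=
  Matrix.fromBlocks 1 0 Cᵀ 1

theorem shear_mul_shear_neg (C : Matrix (Fin 2) (Fin 2) ℝ) : shear C * shear (-C) = 1 := by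
  simp [shear, Matrix.fromBlocks_multiply, ← Matrix.fromBlocks_one]

theorem proj_shear (C : Matrix (Fin 2) (Fin 2) ℝ) (x : Fin 2 ⊕ Fin 2 → ℝ) :
    proj (shear C *ᵥ x) = proj x := by
  ext i
  simp only [proj, shear, Matrix.mulVec, dotProduct, Fintype.sum_sum_type,
    Matrix.fromBlocks_apply₁₁, Matrix.fromBlocks_apply₁₂, Matrix.zero_apply, zero_mul,
    Finset.sum_const_zero, add_zero]
  exact congrFun (Matrix.one_mulVec (proj x)) i

/-- Under the shear, `dz + F dt` becomes `dz + (F + C) dt` while `dt` is unchanged. The case `F = 0`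
block-diagonalises the metric. -/
theorem shear_mul_block (G F H C : Matrix (Fin 2) (Fin 2) ℝ) (hH : H.IsSymm) :
    (shear C)ᵀ * Matrix.fromBlocks (G + F * H * Fᵀ) (F * H) (F * H)ᵀ H * shear C
      = Matrix.fromBlocks (G + (F + C) * H * (F + C)ᵀ) ((F + C) * H) ((F + C) * H)ᵀ H := by
  simp only [shear, Matrix.fromBlocks_transpose, Matrix.fromBlocks_multiply, Matrix.transpose_one,
    Matrix.transpose_zero, Matrix.transpose_transpose, Matrix.transpose_mul, Matrix.transpose_add,
    hH.eq, Matrix.one_mul, Matrix.mul_one, Matrix.zero_mul, Matrix.mul_zero, zero_add]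
  congr 1 <;> noncomm_ring

/-- The standing assumptions on the data of the metric. -/
structure Setup (U : Set (Fin 2 → ℝ)) (H F : (Fin 2 → ℝ) → Matrix (Fin 2) (Fin 2) ℝ)
    (q : (Fin 2 → ℝ) → ℝ) : Prop where
  hU : IsOpen U
  sH : SmoothMat U H
  sF : SmoothMat U F
  sq : ContDiffOn ℝ ∞ q U
  symm : ∀ t ∈ U, (H t).IsSymm
  det : ∀ t ∈ U, 0 < (H t).det
  q0 : ∀ t ∈ U, q t ≠ 0

namespace Setup

variable {U : Set (Fin 2 → ℝ)} {H F : (Fin 2 → ℝ) → Matrix (Fin 2) (Fin 2) ℝ}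
    {q : (Fin 2 → ℝ) → ℝ} (S : Setup U H F q) {t : Fin 2 → ℝ} {x : Fin 2 ⊕ Fin 2 → ℝ}
include S

theorem det_ne : ∀ t ∈ U, (H t).det ≠ 0 := fun t ht => (S.det t ht).ne'

theorem sub_const (C : Matrix (Fin 2) (Fin 2) ℝ) : Setup U H (fun s => F s - C) q :=
  { S with sF := S.sF.sub (SmoothMat.const C) }

theorem metric_eq_linPull (C : Matrix (Fin 2) (Fin 2) ℝ) (hx : proj x ∈ U) :
    metric (nullForm q) H F x
      = linPull (shear C) (metric (nullForm q) H (fun s => F s - C)) x := by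
  simp only [metric, linPull, proj_shear]
  rw [shear_mul_block _ _ _ _ (S.symm _ hx), sub_add_cancel]

/-- The metric is congruent to its block-diagonal part by a unipotent matrix, so its determinant is
`-q² det H`. -/
theorem det_metric (hx : proj x ∈ U) : (metric (nullForm q) H F x).det ≠ 0 := by
  have h : metric (nullForm q) H F x = (shear (F (proj x)))ᵀ * Matrix.fromBlocks
      (nullForm q (proj x)) 0 0 (H (proj x)) * shear (F (proj x)) := by
    have := shear_mul_block (nullForm q (proj x)) 0 _ (F (proj x)) (S.symm _ hx)
    simpa [metric] using this.symm
  rw [h, Matrix.det_mul, Matrix.det_mul, Matrix.det_transpose, Matrix.det_fromBlocks_zero₂₁]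
  have hs : (shear (F (proj x))).det = 1 := by simp [shear]
  rw [hs, one_mul, mul_one, nullForm, Matrix.det_fin_two_of]
  have := S.q0 _ hx
  have := S.det_ne _ hx
  simp [*]

theorem smooth_nullForm : SmoothMat U (nullForm q) := by
  intro a b
  fin_cases a <;> fin_cases b
  exacts [contDiffOn_const, S.sq, S.sq, contDiffOn_const]

theorem smooth_orbit : SmoothMat U (fun s => nullForm q s + F s * H s * (F s)ᵀ) :=
  S.smooth_nullForm.add ((S.sF.mul S.sH).mul S.sF.transpose)

theorem smooth_metric : SmoothMat {x | proj x ∈ U} (metric (nullForm q) H F) :=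
  S.smooth_orbit.blockPull (S.sF.mul S.sH) S.sH

theorem ricci_metric_shear (C : Matrix (Fin 2) (Fin 2) ℝ) (hx : proj x ∈ U)
    (μ ν : Fin 2 ⊕ Fin 2) : ricci (metric (nullForm q) H F) μ ν x
      = ∑ b, ∑ c, shear C b μ * shear C c ν
        * ricci (metric (nullForm q) H (fun s => F s - C)) b c (shear C *ᵥ x) := by
  rw [ricci_congr_on (isOpen_proj_preimage S.hU) (fun y hy => S.metric_eq_linPull C hy) hx]
  exact ricci_linPull (shear_mul_shear_neg C) (isOpen_proj_preimage S.hU)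
    (S.sub_const C).smooth_metric (fun y hy => (S.sub_const C).det_metric hy)
    (by simpa [proj_shear] using hx) μ ν

/-- Both Ricci and the metric pull back by the same congruence. One implication suffices, since the
shear by `-C` supplies the other. -/
theorem einstein_shear (Λ : ℝ) (C : Matrix (Fin 2) (Fin 2) ℝ) (hx : proj x ∈ U)
    (h : ∀ μ ν, ricci (metric (nullForm q) H (fun s => F s - C)) μ ν (shear C *ᵥ x)
      - Λ * metric (nullForm q) H (fun s => F s - C) (shear C *ᵥ x) μ ν = 0)
    (μ ν : Fin 2 ⊕ Fin 2) :
    ricci (metric (nullForm q) H F) μ ν x - Λ * metric (nullForm q) H F x μ ν = 0 := by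
  rw [S.ricci_metric_shear C hx, S.metric_eq_linPull C hx, linPull_apply, Finset.mul_sum,
    ← Finset.sum_sub_distrib]
  refine Finset.sum_eq_zero fun b _ => ?_
  rw [Finset.mul_sum, ← Finset.sum_sub_distrib]
  refine Finset.sum_eq_zero fun c _ => ?_
  rw [sub_eq_zero.1 (h b c)]
  ring

/-- The jet of the data at a point. -/
noncomputable def jet (ht : t ∈ U) : KillingJet where
  q := q t
  dq i := pd i q t
  ddq i j := pd i (pd j q) t
  H := H t
  K := (H t)⁻¹
  dH i := matPd i H t
  ddH i j := matPd i (matPd j H) t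
  dF i := matPd i F t
  ddF i j := matPd i (matPd j F) t
  hq := S.q0 t ht
  hKH := Matrix.nonsing_inv_mul _ (S.det_ne t ht).isUnit
  hK := (Matrix.IsSymm.inv (S.symm t ht)).apply 0 1
  hH := (S.symm t ht).apply 0 1
  hdH _ := pd_congr_on S.hU (fun s hs => (S.symm s hs).apply 0 1) ht
  hddH _ _ := pd_congr_on S.hU
    (fun _ hy => pd_congr_on S.hU (fun s hs => (S.symm s hs).apply 0 1) hy) ht
  hddHc := matPd_comm S.hU S.sH ht
  hddqc := pd_comm S.hU S.sq ht
  hddFc := matPd_comm S.hU S.sF ht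

omit S in
theorem matPd_nullForm (i : Fin 2) : matPd i (nullForm q) t = offDiag (pd i q t) := by
  ext a b
  fin_cases a <;> fin_cases b
  exacts [pd_const 0, rfl, rfl, pd_const 0]

theorem matPd_matPd_nullForm (ht : t ∈ U) (i j : Fin 2) :
    matPd i (matPd j (nullForm q)) t = offDiag (pd i (pd j q) t) := by
  rw [matPd_congr_on S.hU (fun _ _ => matPd_nullForm j) ht]
  ext a b
  fin_cases a <;> fin_cases b
  exacts [pd_const 0, rfl, rfl, pd_const 0]

theorem matPd_FH (ht : t ∈ U) (i : Fin 2) :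
    matPd i (fun s => F s * H s) t = matPd i F t * H t + F t * matPd i H t :=
  matPd_mul S.hU S.sF S.sH ht

theorem matPd_FHF (ht : t ∈ U) (i : Fin 2) :
    matPd i (fun s => F s * H s * (F s)ᵀ) t
      = matPd i (fun s => F s * H s) t * (F t)ᵀ + F t * H t * (matPd i F t)ᵀ := by
  rw [matPd_mul S.hU (S.sF.mul S.sH) S.sF.transpose ht, matPd_transpose]

theorem matPd_metric (hx : proj x ∈ U) (h0 : F (proj x) = 0) (e : Fin 2 ⊕ Fin 2) :
    matPd e (metric (nullForm q) H F) x = (S.jet hx).dg e := by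
  change matPd e (blockPull (fun s => nullForm q s + F s * H s * (F s)ᵀ) (fun s => F s * H s) H) x
    = _
  rw [matPd_blockPull S.hU S.smooth_orbit (S.sF.mul S.sH) S.sH hx]
  simp only [matPd_add S.hU S.smooth_nullForm ((S.sF.mul S.sH).mul S.sF.transpose) hx,
    matPd_nullForm, S.matPd_FHF hx, S.matPd_FH hx, h0]
  simp [KillingJet.dg, jet]

/-- At a zero of `F` only those terms of the product rule survive in which every factor `F` is
differentiated. -/
theorem matPd_matPd_metric (hx : proj x ∈ U) (h0 : F (proj x) = 0) (e f : Fin 2 ⊕ Fin 2) :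
    matPd e (matPd f (metric (nullForm q) H F)) x = (S.jet hx).ddg e f := by
  change matPd e (matPd f
    (blockPull (fun s => nullForm q s + F s * H s * (F s)ᵀ) (fun s => F s * H s) H)) x = _
  have hFH := S.sF.mul S.sH
  have hFHF := hFH.mul S.sF.transpose
  have h1 : ∀ i j, matPd i (matPd j fun s => F s * H s) (proj x)
      = matPd i (matPd j F) (proj x) * H (proj x) + (matPd i F (proj x) * matPd j H (proj x)
        + matPd j F (proj x) * matPd i H (proj x)) := by
    intro i j
    rw [matPd_congr_on S.hU (fun s hs => S.matPd_FH hs j) hx,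
      matPd_add S.hU ((S.sF.matPd S.hU j).mul S.sH) (S.sF.mul (S.sH.matPd S.hU j)) hx,
      matPd_mul S.hU (S.sF.matPd S.hU j) S.sH hx, matPd_mul S.hU S.sF (S.sH.matPd S.hU j) hx, h0]
    rw [Matrix.zero_mul]
    abel
  have h2 : ∀ i j, matPd i (matPd j fun s => nullForm q s + F s * H s * (F s)ᵀ) (proj x)
      = offDiag (pd i (pd j q) (proj x)) + (matPd i F (proj x) * H (proj x) * (matPd j F (proj x))ᵀ
        + matPd j F (proj x) * H (proj x) * (matPd i F (proj x))ᵀ) := by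
    intro i j
    rw [matPd_congr_on S.hU (fun s hs => matPd_add S.hU S.smooth_nullForm hFHF hs) hx,
      matPd_add S.hU (S.smooth_nullForm.matPd S.hU j) (hFHF.matPd S.hU j) hx,
      S.matPd_matPd_nullForm hx, matPd_congr_on S.hU (fun s hs => S.matPd_FHF hs j) hx,
      matPd_add S.hU ((hFH.matPd S.hU j).mul S.sF.transpose)
        (hFH.mul (S.sF.matPd S.hU j).transpose) hx,
      matPd_mul S.hU (hFH.matPd S.hU j) S.sF.transpose hx,
      matPd_mul S.hU hFH (S.sF.matPd S.hU j).transpose hx, matPd_transpose, S.matPd_FH hx,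
      S.matPd_FH hx, h0]
    simp only [Matrix.zero_mul, Matrix.transpose_zero, Matrix.mul_zero, add_zero, zero_add]
    abel
  rw [matPd_matPd_blockPull S.hU S.smooth_orbit hFH S.sH hx]
  simp only [h1, h2]
  rfl

omit S in
theorem metric_of_eq_zero (h0 : F (proj x) = 0) :
    metric (nullForm q) H F x = Matrix.fromBlocks (offDiag (q (proj x))) 0 0 (H (proj x)) := by
  simp [metric, h0, nullForm, offDiag]

theorem inv_metric_of_eq_zero (hx : proj x ∈ U) (h0 : F (proj x) = 0) :
    (metric (nullForm q) H F x)⁻¹ = (S.jet hx).Gi := by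
  apply Matrix.inv_eq_right_inv
  rw [metric_of_eq_zero h0, KillingJet.Gi, Matrix.fromBlocks_multiply]
  have h1 : H (proj x) * (S.jet hx).K = 1 :=
    Matrix.mul_nonsing_inv _ (S.det_ne _ hx).isUnit
  have h2 : offDiag (q (proj x)) * offDiag (1 / (S.jet hx).q) = 1 := by
    have : q (proj x) ≠ 0 := S.q0 _ hx
    ext a b
    fin_cases a <;> fin_cases b <;> simp [Matrix.mul_apply, jet, this]
  simp only [h1, h2, Matrix.mul_zero, Matrix.zero_mul, add_zero, zero_add, Matrix.fromBlocks_one]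

theorem ricci_metric_of_eq_zero (hx : proj x ∈ U) (h0 : F (proj x) = 0) (μ ν : Fin 2 ⊕ Fin 2) :
    ricci (metric (nullForm q) H F) μ ν x
      = jetRicci (S.jet hx).Gi (S.jet hx).dGi (S.jet hx).dg (S.jet hx).ddg μ ν := by
  rw [ricci_eq_jetRicci (isOpen_proj_preimage S.hU) S.smooth_metric (fun y hy => S.det_metric hy)
    hx, S.inv_metric_of_eq_zero hx h0]
  simp only [S.matPd_metric hx h0, S.matPd_matPd_metric hx h0]
  -- Only the derivative of the inverse metric remains to be matched: `-g⁻¹ (∂g) g⁻¹` is multiplied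
  -- out blockwise, with `H K = 1` cancelling in the mixed blocks.
  congr 1
  funext e
  generalize S.jet hx = Z
  rw [KillingJet.dGi, KillingJet.dg, KillingJet.Gi]
  rcases e with i | i
  · simp only [blockD, Sum.elim_inl, Matrix.fromBlocks_multiply, Matrix.fromBlocks_neg]
    have hKt : Z.Kᵀ = Z.K := by
      ext a b; fin_cases a <;> fin_cases b <;> simp [Z.hK]
    have ho : ∀ s, (offDiag s)ᵀ = offDiag s := fun s => by
      ext a b; fin_cases a <;> fin_cases b <;> rfl
    have hHK : Z.H * Z.K = 1 := mul_eq_one_comm.1 Z.hKH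
    have hKHt : Z.K * Z.Hᵀ = 1 := by
      rw [← hKt, ← Matrix.transpose_mul, hHK, Matrix.transpose_one]
    congr 1
    · have hq := Z.hq
      ext a b
      fin_cases a <;> fin_cases b <;> simp [Matrix.mul_apply] <;> field_simp
    · simp [Matrix.mul_assoc, hHK]
    · simp [Matrix.transpose_mul, ho, ← Matrix.mul_assoc, hKHt]
    · simp
  · simp [blockD]

/-- The jet deliberately omits the value of `F` and records only its derivatives, so the shear that
kills this value does not alter it. -/
theorem jet_sub_const (C : Matrix (Fin 2) (Fin 2) ℝ) (ht : t ∈ U) :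
    (S.sub_const C).jet ht = S.jet ht := by
  have h : ∀ i, ∀ s ∈ U, matPd i (fun s => F s - C) s = matPd i F s := fun i s hs => by
    rw [matPd_sub S.hU S.sF (SmoothMat.const C) hs, matPd_const, sub_zero]
  have h' : ∀ i j, matPd i (matPd j (fun s => F s - C)) t = matPd i (matPd j F) t := fun i j =>
    matPd_congr_on S.hU (h j) ht
  simp only [jet, h _ t ht, h']

/-- The Einstein equations at a point, in terms of the jets of the data. -/
theorem einstein_iff (Λ : ℝ) (hx : proj x ∈ U) :
    (∀ μ ν, ricci (metric (nullForm q) H F) μ ν x - Λ * metric (nullForm q) H F x μ ν = 0) ↔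
      ∀ μ ν, jetRicci (S.jet hx).Gi (S.jet hx).dGi (S.jet hx).dg (S.jet hx).ddg μ ν
        = Λ * Matrix.fromBlocks (offDiag (q (proj x))) 0 0 (H (proj x)) μ ν := by
  -- With this constant, `F - C` vanishes at the projected point, which the shear leaves fixed.
  set C := F (proj x) with hC
  have hp : proj (shear C *ᵥ x) = proj x := proj_shear C x
  have key : (∀ μ ν, ricci (metric (nullForm q) H (fun s => F s - C)) μ ν (shear C *ᵥ x)
      - Λ * metric (nullForm q) H (fun s => F s - C) (shear C *ᵥ x) μ ν = 0) ↔
      ∀ μ ν, jetRicci (S.jet hx).Gi (S.jet hx).dGi (S.jet hx).dg (S.jet hx).ddg μ ν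
        = Λ * Matrix.fromBlocks (offDiag (q (proj x))) 0 0 (H (proj x)) μ ν := by
    have h0 : (fun s => F s - C) (proj (shear C *ᵥ x)) = 0 := by
      simp only [hp]; exact sub_self _
    have hx' : proj (shear C *ᵥ x) ∈ U := by rwa [hp]
    have hj : (S.sub_const C).jet hx' = S.jet hx := by
      rw [S.jet_sub_const]
      congr
    have hR : ∀ μ ν, ricci (metric (nullForm q) H (fun s => F s - C)) μ ν (shear C *ᵥ x)
        = jetRicci (S.jet hx).Gi (S.jet hx).dGi (S.jet hx).dg (S.jet hx).ddg μ ν := fun μ ν => by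
      rw [← hj]
      exact (S.sub_const C).ricci_metric_of_eq_zero hx' h0 μ ν
    have hm : metric (nullForm q) H (fun s => F s - C) (shear C *ᵥ x)
        = Matrix.fromBlocks (offDiag (q (proj x))) 0 0 (H (proj x)) := by
      rw [metric_of_eq_zero (F := fun s => F s - C) h0, hp]
    simp only [hR, hm, sub_eq_zero]
  rw [← key]
  refine ⟨fun h => ?_, S.einstein_shear Λ C hx⟩
  -- The converse is the same implication for the inverse shear, applied to the data with `F - C`.
  refine (S.sub_const C).einstein_shear Λ (-C) (by rwa [hp]) ?_
  have h1 : shear (-C) *ᵥ (shear C *ᵥ x) = x := by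
    have := shear_mul_shear_neg (-C)
    rw [neg_neg] at this
    rw [Matrix.mulVec_mulVec, this, Matrix.one_mulVec]
  simpa only [h1, sub_neg_eq_add, sub_add_cancel] using h

end Setup

end G2Metric

/-! ### The reduced system: trace, derivative of the trace, and compatibility. -/

namespace G2Metric

/-- The logarithmic derivative `(ln r)_{,i}`. -/
noncomputable def rho (H : (Fin 2 → ℝ) → Matrix (Fin 2) (Fin 2) ℝ) (i : Fin 2) (t : Fin 2 → ℝ) : ℝ :=
  ((H t)⁻¹ * matPd i H t).trace / 2

/-- The quadratic form `A H⁻¹ Aᵀ`. -/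
noncomputable def twistNorm (H : (Fin 2 → ℝ) → Matrix (Fin 2) (Fin 2) ℝ) (A : Fin 2 → ℝ)
    (t : Fin 2 → ℝ) : ℝ := ((H t)⁻¹ * Matrix.vecMulVec A A).trace

/-- The trace `tr (H⁻¹ H_{,i} H⁻¹ H_{,j})`. -/
noncomputable def quadTrace (H : (Fin 2 → ℝ) → Matrix (Fin 2) (Fin 2) ℝ) (i j : Fin 2)
    (t : Fin 2 → ℝ) : ℝ := ((H t)⁻¹ * matPd i H t * ((H t)⁻¹ * matPd j H t)).trace

/-- The matrix equation, lowered to a symmetric form and divided by `r`. -/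
noncomputable def loweredResidual (Λ : ℝ) (H : (Fin 2 → ℝ) → Matrix (Fin 2) (Fin 2) ℝ)
    (q : (Fin 2 → ℝ) → ℝ) (A : Fin 2 → ℝ) (i j : Fin 2) (t : Fin 2 → ℝ) :
    Matrix (Fin 2) (Fin 2) ℝ :=
  (2 : ℝ) • matPd j (matPd i H) t + rho H j t • matPd i H t + rho H i t • matPd j H t
    - matPd i H t * (H t)⁻¹ * matPd j H t - matPd j H t * (H t)⁻¹ * matPd i H t
    + (2 * Λ * q t) • H t + (q t / rad H t ^ 2) • Matrix.vecMulVec A A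

/-- A quarter of the trace of the matrix equation, divided by `r`. -/
noncomputable def traceResidual (Λ : ℝ) (H : (Fin 2 → ℝ) → Matrix (Fin 2) (Fin 2) ℝ)
    (q : (Fin 2 → ℝ) → ℝ) (A : Fin 2 → ℝ) (i j : Fin 2) (t : Fin 2 → ℝ) : ℝ :=
  pd j (rho H i) t + rho H i t * rho H j t + Λ * q t + q t / (4 * rad H t ^ 2) * twistNorm H A t

theorem twistNorm_eq (H : (Fin 2 → ℝ) → Matrix (Fin 2) (Fin 2) ℝ) (A : Fin 2 → ℝ)
    (t : Fin 2 → ℝ) : twistNorm H A t = A ⬝ᵥ ((H t)⁻¹ *ᵥ A) := by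
  simp [twistNorm, Matrix.trace, Matrix.mul_apply, Matrix.vecMulVec_apply, dotProduct,
    Matrix.mulVec, Fin.sum_univ_two]
  ring

theorem quadTrace_comm (H : (Fin 2 → ℝ) → Matrix (Fin 2) (Fin 2) ℝ) (i j : Fin 2)
    (t : Fin 2 → ℝ) : quadTrace H i j t = quadTrace H j i t := Matrix.trace_mul_comm _ _

namespace Setup

variable {U : Set (Fin 2 → ℝ)} {H F : (Fin 2 → ℝ) → Matrix (Fin 2) (Fin 2) ℝ}
    {q : (Fin 2 → ℝ) → ℝ} (S : Setup U H F q) {t : Fin 2 → ℝ} {Λ : ℝ} {A : Fin 2 → ℝ}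
    {i j : Fin 2}
include S

theorem rad_pos (ht : t ∈ U) : 0 < rad H t := Real.sqrt_pos.2 (S.det t ht)

theorem smooth_det : ContDiffOn ℝ ∞ (fun s => (H s).det) U := contDiffOn_det S.sH

theorem smooth_rad : ContDiffOn ℝ ∞ (rad H) U := S.smooth_det.sqrt S.det_ne

theorem smooth_inv : SmoothMat U (fun s => (H s)⁻¹) := S.sH.inv S.det_ne

theorem smooth_rho (i : Fin 2) : ContDiffOn ℝ ∞ (rho H i) U :=
  ((S.smooth_inv.mul (S.sH.matPd S.hU i)).trace).div_const 2

theorem smooth_twistNorm (A : Fin 2 → ℝ) : ContDiffOn ℝ ∞ (twistNorm H A) U :=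
  (S.smooth_inv.mul (SmoothMat.const _)).trace

theorem smooth_quadTrace (i j : Fin 2) : ContDiffOn ℝ ∞ (quadTrace H i j) U :=
  ((S.smooth_inv.mul (S.sH.matPd S.hU i)).mul (S.smooth_inv.mul (S.sH.matPd S.hU j))).trace

theorem inv_mul (ht : t ∈ U) : (H t)⁻¹ * H t = 1 :=
  Matrix.nonsing_inv_mul _ (S.det_ne t ht).isUnit

theorem mul_inv (ht : t ∈ U) : H t * (H t)⁻¹ = 1 :=
  Matrix.mul_nonsing_inv _ (S.det_ne t ht).isUnit

/-- Jacobi's formula. -/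
theorem pd_det (ht : t ∈ U) (i : Fin 2) :
    pd i (fun s => (H s).det) t = (H t).det * (2 * rho H i t) := by
  have hd : ∀ a b, DifferentiableAt ℝ (fun s => H s a b) t := fun a b => (S.sH a b).dAt S.hU ht
  have h0 := S.det_ne t ht
  have h1 : (H t).det * (2 * rho H i t) = ((H t).adjugate * matPd i H t).trace := by
    rw [rho, Matrix.inv_def, Ring.inverse_eq_inv', Matrix.smul_mul, Matrix.trace_smul, smul_eq_mul]
    field_simp
  rw [h1]
  simp only [Matrix.det_fin_two]
  rw [pd_sub ((hd 0 0).fun_mul (hd 1 1)) ((hd 0 1).fun_mul (hd 1 0)), pd_mul (hd _ _) (hd _ _),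
    pd_mul (hd _ _) (hd _ _), Matrix.adjugate_fin_two]
  simp only [Matrix.trace_fin_two, Matrix.mul_apply, Fin.sum_univ_two, matPd, Matrix.of_apply,
    Matrix.cons_val', Matrix.cons_val_zero, Matrix.cons_val_one, Matrix.cons_val_fin_one]
  ring

theorem pd_rad (ht : t ∈ U) (i : Fin 2) : pd i (rad H) t = rad H t * rho H i t := by
  have h := S.rad_pos ht
  change pd i (fun s => √(H s).det) t = _
  rw [pd_sqrt (S.smooth_det.dAt S.hU ht) (S.det_ne t ht), S.pd_det ht]
  have h2 : (H t).det = rad H t ^ 2 := (Real.sq_sqrt (S.det t ht).le).symm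
  rw [h2, Real.sqrt_sq h.le]
  field_simp

theorem pd_log_rad (ht : t ∈ U) (i : Fin 2) : pd i (fun s => Real.log (rad H s)) t = rho H i t := by
  have h := (S.rad_pos ht).ne'
  rw [pd_log (S.smooth_rad.dAt S.hU ht) h, S.pd_rad ht]
  field_simp

/-- The inverse of a null-form metric is off-diagonal, so `C_ρ` is a multiple of the product of the
two derivatives of `det H`; neither factor can vanish. -/
theorem rho_ne_zero (hC : cRho (nullForm q) H t ≠ 0) (ht : t ∈ U) (i : Fin 2) : rho H i t ≠ 0 := by
  intro h
  apply hC
  have hinv : ∀ a b, (nullForm q t)⁻¹ a b = offDiag (q t)⁻¹ a b := by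
    have hq := S.q0 t ht
    have : (nullForm q t)⁻¹ = offDiag (q t)⁻¹ := by
      apply Matrix.inv_eq_right_inv
      ext a b
      fin_cases a <;> fin_cases b <;> simp [Matrix.mul_apply, nullForm, hq]
    simp [this]
  have hd : pd i (fun s => (H s).det) t = 0 := by rw [S.pd_det ht, h]; ring
  rw [cRho]
  fin_cases i <;> simp_all [Fin.sum_univ_two]

theorem pd_inv_mul (ht : t ∈ U) (B : (Fin 2 → ℝ) → Matrix (Fin 2) (Fin 2) ℝ) (hB : SmoothMat U B)
    (j : Fin 2) : matPd j (fun s => (H s)⁻¹ * B s) t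
      = (H t)⁻¹ * matPd j B t - (H t)⁻¹ * matPd j H t * ((H t)⁻¹ * B t) := by
  rw [matPd_mul S.hU S.smooth_inv hB ht, matPd_inv S.hU S.sH S.det_ne ht]
  noncomm_ring

theorem pd_rho (ht : t ∈ U) (i j : Fin 2) : pd j (rho H i) t
    = (((H t)⁻¹ * matPd j (matPd i H) t).trace - quadTrace H j i t) / 2 := by
  have hs := S.smooth_inv.mul (S.sH.matPd S.hU i)
  have h : rho H i = fun s => (1 / 2) * ((H s)⁻¹ * matPd i H s).trace := by
    ext s; rw [rho]; ring
  rw [h, pd_const_mul _ (hs.trace.dAt S.hU ht), pd_trace S.hU hs ht,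
    S.pd_inv_mul ht _ (S.sH.matPd S.hU i), Matrix.trace_sub, quadTrace]
  ring

theorem pd_twistNorm (ht : t ∈ U) (A : Fin 2 → ℝ) (j : Fin 2) : pd j (twistNorm H A) t
    = -((H t)⁻¹ * matPd j H t * ((H t)⁻¹ * Matrix.vecMulVec A A)).trace := by
  change pd j (fun s => ((H s)⁻¹ * Matrix.vecMulVec A A).trace) t = _
  rw [pd_trace S.hU (S.smooth_inv.mul (SmoothMat.const _)) ht,
    S.pd_inv_mul ht _ (SmoothMat.const _), matPd_const]
  simp

theorem pd_quadTrace (ht : t ∈ U) (i j : Fin 2) : pd j (quadTrace H i i) t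
    = 2 * (((H t)⁻¹ * matPd j (matPd i H) t - (H t)⁻¹ * matPd j H t * ((H t)⁻¹ * matPd i H t))
      * ((H t)⁻¹ * matPd i H t)).trace := by
  have hs := S.smooth_inv.mul (S.sH.matPd S.hU i)
  change pd j (fun s => ((H s)⁻¹ * matPd i H s * ((H s)⁻¹ * matPd i H s)).trace) t = _
  rw [pd_trace S.hU (hs.mul hs) ht, matPd_mul S.hU hs hs ht,
    S.pd_inv_mul ht _ (S.sH.matPd S.hU i), Matrix.trace_add, Matrix.trace_mul_comm _ (_ - _)]
  ring

theorem matPd_flux (ht : t ∈ U) (i j : Fin 2) :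
    matPd j (fun s => rad H s • (matPd i H s * (H s)⁻¹)) t
      = (rad H t * rho H j t) • (matPd i H t * (H t)⁻¹) + rad H t •
        (matPd j (matPd i H) t * (H t)⁻¹ - matPd i H t * (H t)⁻¹ * matPd j H t * (H t)⁻¹) := by
  rw [matPd_smul S.hU S.smooth_rad ((S.sH.matPd S.hU i).mul S.smooth_inv) ht, S.pd_rad ht,
    matPd_mul S.hU (S.sH.matPd S.hU i) S.smooth_inv ht, matPd_inv S.hU S.sH S.det_ne ht]
  noncomm_ring

/-- Allowing both orders of the two indices lets one derivation serve both scalar equations. -/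
theorem matrixResidual_eq (ht : t ∈ U) (hij : i ≠ j) :
    matrixResidual Λ H q A t = rad H t • (loweredResidual Λ H q A i j t * (H t)⁻¹) := by
  have hr := (S.rad_pos ht).ne'
  have h0 : matPd 1 (fun s => rad H s • (matPd 0 H s * (H s)⁻¹)) t
      + matPd 0 (fun s => rad H s • (matPd 1 H s * (H s)⁻¹)) t
      = matPd j (fun s => rad H s • (matPd i H s * (H s)⁻¹)) t
      + matPd i (fun s => rad H s • (matPd j H s * (H s)⁻¹)) t := by
    fin_cases i <;> fin_cases j <;> first | exact absurd rfl hij | skip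
    · rfl
    · exact add_comm _ _
  have h1 : (q t / rad H t) • (Matrix.vecMulVec A A * (H t)⁻¹)
      = rad H t • ((q t / rad H t ^ 2) • (Matrix.vecMulVec A A * (H t)⁻¹)) := by
    rw [smul_smul]; congr 1; field_simp
  -- The unit matrix is rewritten as `H H⁻¹`, so that the `Λ` term acquires the common right factor
  -- `H⁻¹` as well.
  rw [matrixResidual, h0, S.matPd_flux ht, S.matPd_flux ht, h1, loweredResidual,
    matPd_comm S.hU S.sH ht (i := i), ← S.mul_inv ht]
  simp only [add_mul, sub_mul, Matrix.smul_mul]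
  module

theorem matrixEq_iff (ht : t ∈ U) (hij : i ≠ j) :
    MatrixEq Λ H q A t ↔ loweredResidual Λ H q A i j t = 0 := by
  have h : MatrixEq Λ H q A t ↔ matrixResidual Λ H q A t = 0 := by
    rw [MatrixEq, matrixResidual, ← sub_eq_zero]
    apply Eq.congr _ rfl
    abel
  rw [h, S.matrixResidual_eq ht hij]
  constructor
  · intro h
    have h1 := (smul_eq_zero.1 h).resolve_left (S.rad_pos ht).ne'
    have h2 : loweredResidual Λ H q A i j t * (H t)⁻¹ * H t = 0 := by rw [h1, zero_mul]
    rwa [Matrix.mul_assoc, S.inv_mul ht, Matrix.mul_one] at h2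
  · intro h
    rw [h, zero_mul, smul_zero]

/-- The products `H_{,i} H⁻¹ H_{,j}` contribute precisely the quadratic traces that come from
differentiating `H⁻¹` in `rho`. They cancel, leaving an equation for `ln r` alone apart from the
source terms. -/
theorem trace_matrixResidual (ht : t ∈ U) (hij : i ≠ j) :
    (matrixResidual Λ H q A t).trace = 4 * rad H t * traceResidual Λ H q A i j t := by
  rw [S.matrixResidual_eq ht hij, Matrix.trace_smul, Matrix.trace_mul_comm, loweredResidual,
    traceResidual, S.pd_rho ht, quadTrace_comm, quadTrace, twistNorm]
  simp only [mul_add, mul_sub, Matrix.mul_smul, Matrix.trace_add, Matrix.trace_sub,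
    Matrix.trace_smul, smul_eq_mul, S.inv_mul ht, Matrix.trace_one]
  have h1 : ∀ a b, ((H t)⁻¹ * (matPd a H t * (H t)⁻¹ * matPd b H t)).trace
      = ((H t)⁻¹ * matPd a H t * ((H t)⁻¹ * matPd b H t)).trace := fun a b => by
    simp only [Matrix.mul_assoc]
  have h2 := Matrix.trace_mul_comm ((H t)⁻¹ * matPd j H t) ((H t)⁻¹ * matPd i H t)
  have h3 : ∀ a, ((H t)⁻¹ * matPd a H t).trace = 2 * rho H a t := fun a => by rw [rho]; ring
  rw [h1, h1, h2, h3, h3]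
  simp
  field_simp
  ring

theorem traceResidual_eq_zero (ht : t ∈ U) (hij : i ≠ j) (h : MatrixEq Λ H q A t) :
    traceResidual Λ H q A i j t = 0 := by
  have h1 := S.trace_matrixResidual (Λ := Λ) (A := A) ht hij
  rw [S.matrixResidual_eq ht hij, (S.matrixEq_iff ht hij).1 h] at h1
  have := (S.rad_pos ht).ne'
  simpa [this] using h1

/-- The mixed second derivative of `r`. -/
theorem pd_pd_rad (ht : t ∈ U) (h : MatrixEq Λ H q A t) :
    pd 1 (pd 0 (rad H)) t = -Λ * q t * rad H t
      - q t / (4 * rad H t) * (A ⬝ᵥ ((H t)⁻¹ *ᵥ A)) := by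
  have hr := (S.rad_pos ht).ne'
  rw [pd_congr_on S.hU (g := fun s => rad H s * rho H 0 s) (fun s hs => S.pd_rad hs 0) ht,
    pd_mul (S.smooth_rad.dAt S.hU ht) ((S.smooth_rho 0).dAt S.hU ht), S.pd_rad ht, ← twistNorm_eq]
  have h1 := S.traceResidual_eq_zero ht zero_ne_one h
  rw [traceResidual] at h1
  -- Since `r_{,12} = r (ρ_{1,2} + ρ_1 ρ_2)`, the difference of the two sides is `r` times the trace
  -- residual.
  rw [← sub_eq_zero, ← mul_zero (rad H t), ← h1]
  field_simp
  ring

theorem smooth_flux (i : Fin 2) : SmoothMat U fun s => rad H s • (matPd i H s * (H s)⁻¹) :=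
  SmoothMat.smul S.smooth_rad ((S.sH.matPd S.hU i).mul S.smooth_inv)

theorem smooth_matrixResidual (Λ : ℝ) (A : Fin 2 → ℝ) :
    SmoothMat U (matrixResidual Λ H q A) := by
  refine ((((S.smooth_flux 0).matPd S.hU 1).add ((S.smooth_flux 1).matPd S.hU 0)).add
    (SmoothMat.smul ?_ (SmoothMat.const 1))).add
    (SmoothMat.smul ?_ ((SmoothMat.const (Matrix.vecMulVec A A)).mul S.smooth_inv))
  · exact (contDiffOn_const.mul S.sq).mul S.smooth_rad
  · exact S.sq.div S.smooth_rad fun s hs => (S.rad_pos hs).ne'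

theorem smooth_twistCoeff : ContDiffOn ℝ ∞ (fun s => q s / (4 * rad H s ^ 2)) U :=
  S.sq.div (contDiffOn_const.mul (S.smooth_rad.pow 2)) fun s hs => by
    have := (S.rad_pos hs).ne'
    positivity

theorem pd_twistCoeff (ht : t ∈ U) (i : Fin 2) : pd i (fun s => q s / (4 * rad H s ^ 2)) t
    = pd i q t / (4 * rad H t ^ 2) - q t * rho H i t / (2 * rad H t ^ 2) := by
  have hr := (S.rad_pos ht).ne'
  have hrd := S.smooth_rad.dAt S.hU ht
  have h : (fun s => q s / (4 * rad H s ^ 2)) = fun s => q s / (4 * (rad H s * rad H s)) := by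
    ext s; rw [pow_two]
  rw [h, pd_div (S.sq.dAt S.hU ht) ((hrd.fun_mul hrd).const_mul 4) (by positivity),
    pd_const_mul _ (hrd.fun_mul hrd), pd_mul hrd hrd, S.pd_rad ht]
  field_simp
  ring

theorem pd_rho_comm (ht : t ∈ U) (i j : Fin 2) : pd j (rho H i) t = pd i (rho H j) t := by
  rw [S.pd_rho ht, S.pd_rho ht, quadTrace_comm, matPd_comm S.hU S.sH ht]

theorem smooth_traceResidual (Λ : ℝ) (A : Fin 2 → ℝ) (i j : Fin 2) :
    ContDiffOn ℝ ∞ (traceResidual Λ H q A i j) U :=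
  (((contDiffOn_pd S.hU (S.smooth_rho i) j).add ((S.smooth_rho i).mul (S.smooth_rho j))).add
    (contDiffOn_const.mul S.sq)).add (S.smooth_twistCoeff.mul (S.smooth_twistNorm A))

theorem pd_traceResidual (ht : t ∈ U) (i j k : Fin 2) : pd k (traceResidual Λ H q A i j) t
    = pd k (pd j (rho H i)) t + (pd k (rho H i) t * rho H j t + rho H i t * pd k (rho H j) t)
      + Λ * pd k q t
      + ((pd k q t / (4 * rad H t ^ 2) - q t * rho H k t / (2 * rad H t ^ 2)) * twistNorm H A t
        + q t / (4 * rad H t ^ 2) * pd k (twistNorm H A) t) := by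
  have h1 := (contDiffOn_pd S.hU (S.smooth_rho i) j).dAt S.hU ht
  have h2 := (S.smooth_rho i).dAt S.hU ht
  have h3 := (S.smooth_rho j).dAt S.hU ht
  have h4 := S.sq.dAt S.hU ht
  have h5 := S.smooth_twistCoeff.dAt S.hU ht
  have h6 := (S.smooth_twistNorm A).dAt S.hU ht
  unfold traceResidual
  rw [pd_add ((h1.fun_add (h2.fun_mul h3)).fun_add (h4.const_mul Λ)) (h5.fun_mul h6),
    pd_add (h1.fun_add (h2.fun_mul h3)) (h4.const_mul Λ), pd_add h1 (h2.fun_mul h3),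
    pd_mul h2 h3, pd_const_mul _ h4, pd_mul h5 h6, S.pd_twistCoeff ht]

/-- The trace of the differentiated matrix equation is the derivative of `4 r` times the trace
residual. The term with the derivative of `r` drops because the residual itself vanishes at `t`, so
information at the single point is enough. -/
theorem pd_traceResidual_eq_zero (ht : t ∈ U) (hij : i ≠ j) (h : MatrixEq Λ H q A t) (k : Fin 2)
    (hd : matPd k (matrixResidual Λ H q A) t = 0) : pd k (traceResidual Λ H q A i j) t = 0 := by
  have hr := (S.rad_pos ht).ne'
  have h1 := pd_trace S.hU (S.smooth_matrixResidual Λ A) ht (i := k)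
  have hrd := S.smooth_rad.dAt S.hU ht
  rw [hd, Matrix.trace_zero, pd_congr_on S.hU
    (fun s hs => S.trace_matrixResidual (Λ := Λ) (A := A) hs hij) ht,
    pd_mul (hrd.const_mul 4) ((S.smooth_traceResidual Λ A i j).dAt S.hU ht),
    S.traceResidual_eq_zero ht hij h, mul_zero, zero_add] at h1
  simpa [hr] using h1

/-- The matrix equation eliminates `H_{,ij}`. The cubic traces then cancel by cyclicity, and the
rank-one source is recognised as a derivative of `twistNorm`. -/
theorem pd_quadTrace_of_matrixEq (ht : t ∈ U) (hij : i ≠ j) (h : MatrixEq Λ H q A t) :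
    pd j (quadTrace H i i) t = -rho H j t * quadTrace H i i t - rho H i t * quadTrace H i j t
      - 4 * Λ * q t * rho H i t + q t / rad H t ^ 2 * pd i (twistNorm H A) t := by
  have h1 := (S.matrixEq_iff ht hij).1 h
  rw [loweredResidual] at h1
  have h2 : (2 : ℝ) • matPd j (matPd i H) t = matPd i H t * (H t)⁻¹ * matPd j H t
      + matPd j H t * (H t)⁻¹ * matPd i H t - rho H j t • matPd i H t - rho H i t • matPd j H t
      - (2 * Λ * q t) • H t - (q t / rad H t ^ 2) • Matrix.vecMulVec A A := by
    rw [← sub_eq_zero, ← h1]; abel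
  -- The factor 2 is moved onto the second derivative, the form in which the matrix equation gives
  -- it.
  have h3 : ∀ B C : Matrix (Fin 2) (Fin 2) ℝ, 2 * (((H t)⁻¹ * B - C) * ((H t)⁻¹ * matPd i H t)).trace
      = (((H t)⁻¹ * ((2 : ℝ) • B) - (2 : ℝ) • C) * ((H t)⁻¹ * matPd i H t)).trace := by
    intro B C
    rw [Matrix.mul_smul, ← smul_sub, Matrix.smul_mul, Matrix.trace_smul, smul_eq_mul]
  rw [S.pd_quadTrace ht, S.pd_twistNorm ht, h3, h2, quadTrace, quadTrace,
    Matrix.trace_mul_comm ((H t)⁻¹ * matPd i H t) ((H t)⁻¹ * matPd j H t),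
    Matrix.trace_mul_comm ((H t)⁻¹ * matPd i H t) ((H t)⁻¹ * Matrix.vecMulVec A A)]
  have h4 : rho H i t = ((H t)⁻¹ * matPd i H t).trace / 2 := rfl
  have h5 : ((H t)⁻¹ * (matPd i H t * (H t)⁻¹ * matPd j H t) * ((H t)⁻¹ * matPd i H t)).trace
      = ((H t)⁻¹ * matPd j H t * ((H t)⁻¹ * matPd i H t) * ((H t)⁻¹ * matPd i H t)).trace := by
    have := Matrix.trace_mul_comm ((H t)⁻¹ * matPd i H t)
      ((H t)⁻¹ * matPd j H t * ((H t)⁻¹ * matPd i H t))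
    simpa only [Matrix.mul_assoc] using this
  have h6 : ((H t)⁻¹ * (matPd j H t * (H t)⁻¹ * matPd i H t) * ((H t)⁻¹ * matPd i H t)).trace
      = ((H t)⁻¹ * matPd j H t * ((H t)⁻¹ * matPd i H t) * ((H t)⁻¹ * matPd i H t)).trace := by
    simp only [Matrix.mul_assoc]
  simp only [mul_add, mul_sub, add_mul, sub_mul, Matrix.mul_smul, Matrix.smul_mul,
    Matrix.trace_add, Matrix.trace_sub, Matrix.trace_smul, smul_eq_mul, S.inv_mul ht, h5, h6,
    Matrix.one_mul]
  rw [h4]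
  ring

theorem scalarRhs_eq (ht : t ∈ U) (hρ : ∀ s ∈ U, rho H i s ≠ 0) : scalarRhs H i t
    = pd i (rho H i) t / rho H i t + quadTrace H i i t / (4 * rho H i t) := by
  have h1 : (matPd i H t * (H t)⁻¹ * matPd i H t * (H t)⁻¹).trace = quadTrace H i i t := by
    have := Matrix.trace_mul_comm (H t)⁻¹ (matPd i H t * (H t)⁻¹ * matPd i H t)
    rw [← this, quadTrace]
    simp only [Matrix.mul_assoc]
  rw [scalarRhs, h1, S.pd_log_rad ht, pd_congr_on S.hU (g := fun s => Real.log (rho H i s))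
    (fun s hs => by simp only [S.pd_log_rad hs]) ht,
    pd_log ((S.smooth_rho i).dAt S.hU ht) (hρ t ht)]

theorem pd_log_q (ht : t ∈ U) (i : Fin 2) :
    pd i (fun s => Real.log (q s)) t = pd i q t / q t :=
  pd_log (S.sq.dAt S.hU ht) (S.q0 t ht)

/-- The mixed derivative of `ln q` determined by the system. -/
theorem pd_scalarRhs (ht : t ∈ U) (hij : i ≠ j) (hρ : ∀ s ∈ U, rho H i s ≠ 0)
    (h : MatrixEq Λ H q A t) (hd : matPd i (matrixResidual Λ H q A) t = 0)
    (hs : ScalarEq H q i t) : pd j (scalarRhs H i) t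
      = -pd j (rho H i) t - quadTrace H i j t / 4 - Λ * q t
        + q t / (2 * rad H t ^ 2) * twistNorm H A t := by
  have hr := (S.rad_pos ht).ne'
  have hq := S.q0 t ht
  have ha := hρ t ht
  have e1 := (S.smooth_rho i).dAt S.hU ht
  have e2 := (contDiffOn_pd S.hU (S.smooth_rho i) i).dAt S.hU ht
  have e3 := (S.smooth_quadTrace i i).dAt S.hU ht
  have e4 : DifferentiableAt ℝ (fun s => pd i (rho H i) s / rho H i s) t := by
    simpa only [div_eq_mul_inv] using e2.fun_mul (e1.fun_inv ha)
  have e5 : DifferentiableAt ℝ (fun s => quadTrace H i i s / (4 * rho H i s)) t := by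
    simpa only [div_eq_mul_inv] using e3.fun_mul ((e1.const_mul 4).fun_inv (by simpa using ha))
  rw [pd_congr_on S.hU (g := fun s => pd i (rho H i) s / rho H i s
    + quadTrace H i i s / (4 * rho H i s)) (fun s hs => S.scalarRhs_eq hs hρ) ht,
    pd_add e4 e5,
    pd_div e2 e1 ha, pd_div e3 (e1.const_mul 4) (by simpa using ha), pd_const_mul _ e1,
    S.pd_quadTrace_of_matrixEq ht hij h, pd_comm S.hU (S.smooth_rho i) ht]
  have hG := S.traceResidual_eq_zero ht hij h
  have hG1 := S.pd_traceResidual_eq_zero ht hij h i hd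
  rw [S.pd_traceResidual ht, S.pd_rho_comm ht j i] at hG1
  rw [ScalarEq, S.scalarRhs_eq ht hρ, S.pd_log_q ht] at hs
  rw [traceResidual] at hG
  have hs' : pd i q t - q t * (pd i (rho H i) t / rho H i t
      + quadTrace H i i t / (4 * rho H i t)) = 0 := by
    rw [← hs]; field_simp; ring
  -- What remains is an identity of rational functions in which the jet coordinates are independent
  -- variables.
  generalize pd i (pd j (rho H i)) t = T at *
  generalize pd i (rho H i) t = a1 at *
  generalize pd j (rho H i) t = c at *
  generalize rho H i t = a at *
  generalize rho H j t = b at *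
  generalize quadTrace H i i t = u at *
  generalize quadTrace H i j t = v at *
  generalize pd i (twistNorm H A) t = α' at *
  generalize twistNorm H A t = α at *
  generalize pd i q t = q' at *
  generalize q t = p at *
  generalize rad H t = r at *
  -- The three multiples eliminate, in order, the second derivative of `rho H i` by the
  -- differentiated trace equation, its first derivative across by the trace equation, and the
  -- derivative of `q` by the scalar equation. The derivative of `twistNorm` cancels against the one
  -- from `pd_quadTrace_of_matrixEq`.
  linear_combination (norm := (field_simp; ring)) (1 / a) * hG1
    - ((a1 / a + u / (4 * a)) / a) * hG - (1 / a) * (Λ + α / (4 * r ^ 2)) * hs'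

/-- Compatibility of the reduced system. -/
theorem compatibleAt (ht : t ∈ U) (hρ : ∀ i, ∀ s ∈ U, rho H i s ≠ 0) : CompatibleAt Λ H q A t := by
  intro h hd h0 h1
  rw [S.pd_scalarRhs ht zero_ne_one (hρ 0) h (hd 0) h0,
    S.pd_scalarRhs ht one_ne_zero (hρ 1) h (hd 1) h1, quadTrace_comm, S.pd_rho_comm ht]

end Setup

end G2Metric

/-! ### Equivalence of the Einstein equations with the reduced system. -/

namespace G2Metric

/-- The lowered field strength `(F_{1,2} - F_{2,1}) H`. -/
noncomputable def loweredTwist (H F : (Fin 2 → ℝ) → Matrix (Fin 2) (Fin 2) ℝ)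
    (t : Fin 2 → ℝ) : Fin 2 → ℝ :=
  (matPd 1 F t 0 - matPd 0 F t 1) ᵥ* H t

/-- The conserved twist density `(r / q) (F_{1,2} - F_{2,1}) H`. -/
noncomputable def twistDensity (H F : (Fin 2 → ℝ) → Matrix (Fin 2) (Fin 2) ℝ)
    (q : (Fin 2 → ℝ) → ℝ) (k : Fin 2) (t : Fin 2 → ℝ) : ℝ :=
  rad H t / q t * loweredTwist H F t k

namespace Setup

variable {U : Set (Fin 2 → ℝ)} {H F : (Fin 2 → ℝ) → Matrix (Fin 2) (Fin 2) ℝ}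
    {q : (Fin 2 → ℝ) → ℝ} (S : Setup U H F q) {t : Fin 2 → ℝ} {Λ : ℝ} {A : Fin 2 → ℝ}
    {i j : Fin 2}
include S

theorem twistEq_iff (ht : t ∈ U) :
    TwistEq H F q A t ↔ loweredTwist H F t = (q t / rad H t) • A := by
  change matPd 1 F t 0 - matPd 0 F t 1 = (q t / rad H t) • (A ᵥ* (H t)⁻¹) ↔ _
  rw [loweredTwist]
  constructor
  · intro h
    rw [h, Matrix.smul_vecMul, Matrix.vecMul_vecMul, S.inv_mul ht, Matrix.vecMul_one]
  · intro h
    rw [← Matrix.smul_vecMul, ← h, Matrix.vecMul_vecMul, S.mul_inv ht, Matrix.vecMul_one]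

theorem twistEq_iff_twistDensity (ht : t ∈ U) :
    TwistEq H F q A t ↔ ∀ k, twistDensity H F q k t = A k := by
  have hr := (S.rad_pos ht).ne'
  have hq := S.q0 t ht
  rw [S.twistEq_iff ht, funext_iff]
  refine forall_congr' fun k => ?_
  rw [twistDensity, Pi.smul_apply, smul_eq_mul]
  constructor
  · intro h; rw [h]; field_simp
  · intro h; rw [← h]; field_simp

theorem smooth_loweredTwist (k : Fin 2) : ContDiffOn ℝ ∞ (fun s => loweredTwist H F s k) U := by
  change ContDiffOn ℝ ∞ (fun s => ∑ l, (matPd 1 F s 0 l - matPd 0 F s 1 l) * H s l k) U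
  exact ContDiffOn.sum fun l _ =>
    ((S.sF.matPd S.hU 1 0 l).sub (S.sF.matPd S.hU 0 1 l)).mul (S.sH l k)

theorem smooth_twistDensity (k : Fin 2) : ContDiffOn ℝ ∞ (twistDensity H F q k) U :=
  (S.smooth_rad.div S.sq S.q0).mul (S.smooth_loweredTwist k)

theorem pd_loweredTwist (ht : t ∈ U) (e k : Fin 2) : pd e (fun s => loweredTwist H F s k) t
    = ((matPd e (matPd 1 F) t 0 - matPd e (matPd 0 F) t 1) ᵥ* H t) k
      + ((matPd 1 F t 0 - matPd 0 F t 1) ᵥ* matPd e H t) k := by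
  have h1 : ∀ l, DifferentiableAt ℝ (fun s => matPd 1 F s 0 l) t := fun l =>
    (S.sF.matPd S.hU 1 0 l).dAt S.hU ht
  have h2 : ∀ l, DifferentiableAt ℝ (fun s => matPd 0 F s 1 l) t := fun l =>
    (S.sF.matPd S.hU 0 1 l).dAt S.hU ht
  have h3 : ∀ l, DifferentiableAt ℝ (fun s => H s l k) t := fun l => (S.sH l k).dAt S.hU ht
  change pd e (fun s => ∑ l, (matPd 1 F s 0 l - matPd 0 F s 1 l) * H s l k) t = _
  rw [pd_sum fun l _ => ((h1 l).fun_sub (h2 l)).fun_mul (h3 l)]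
  simp only [Matrix.vecMul, dotProduct]
  rw [← Finset.sum_add_distrib]
  refine Finset.sum_congr rfl fun l _ => ?_
  rw [pd_mul ((h1 l).fun_sub (h2 l)) (h3 l), pd_sub (h1 l) (h2 l)]
  rfl

theorem pd_twistDensity (ht : t ∈ U) (e k : Fin 2) :
    pd e (twistDensity H F q k) t = rad H t / q t * (S.jet ht).dw e k := by
  have hq := S.q0 t ht
  have h1 := S.smooth_rad.dAt S.hU ht
  have h2 := S.sq.dAt S.hU ht
  have h3 := (S.smooth_loweredTwist k).dAt S.hU ht
  have h4 : DifferentiableAt ℝ (fun s => rad H s / q s) t :=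
    (S.smooth_rad.div S.sq S.q0).dAt S.hU ht
  have h5 : (S.jet ht).dw e k = (rho H e t - pd e q t / q t) * loweredTwist H F t k
    + (((matPd e (matPd 1 F) t 0 - matPd e (matPd 0 F) t 1) ᵥ* H t) k
      + ((matPd 1 F t 0 - matPd 0 F t 1) ᵥ* matPd e H t) k) := rfl
  unfold twistDensity
  rw [pd_mul h4 h3, pd_div h1 h2 hq, S.pd_rad ht, S.pd_loweredTwist ht, h5]
  field_simp

/-- The twist equation says that the twist density is the constant `A`. The `dw` are its partial
derivatives up to the factor `r / q`, and on a connected open set a vanishing gradient means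
constancy. -/
theorem exists_twistEq_iff (hUc : IsConnected U) :
    (∃ A : Fin 2 → ℝ, ∀ t ∈ U, TwistEq H F q A t)
      ↔ ∀ t (ht : t ∈ U) (e k : Fin 2), (S.jet ht).dw e k = 0 := by
  constructor
  · rintro ⟨A, hA⟩ t ht e k
    have h := S.pd_twistDensity ht e k
    rw [pd_congr_on S.hU (g := fun _ => A k)
      (fun s hs => (S.twistEq_iff_twistDensity hs).1 (hA s hs) k) ht, pd_const] at h
    have hr := (S.rad_pos ht).ne'
    have hq := S.q0 t ht
    simpa [hr, hq] using h.symm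
  · intro h
    have h1 : ∀ k, ∃ a, ∀ t ∈ U, twistDensity H F q k t = a := fun k => by
      refine S.hU.exists_is_const_of_fderiv_eq_zero hUc.isPreconnected
        ((S.smooth_twistDensity k).differentiableOn (by simp)) fun t ht => ?_
      ext v
      rw [fderiv_eq_sum_pd]
      simp [S.pd_twistDensity ht, h t ht]
    choose A hA using h1
    exact ⟨A, fun t ht => (S.twistEq_iff_twistDensity ht).2 fun k => hA k t ht⟩

/-- The Ricci component is `rho H i` times the defect of the scalar equation. No `Λ` appears because
the diagonal of the null form is zero. -/
theorem scalarEq_iff (ht : t ∈ U) (hρ : ∀ s ∈ U, rho H i s ≠ 0) : ScalarEq H q i t ↔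
    jetRicci (S.jet ht).Gi (S.jet ht).dGi (S.jet ht).dg (S.jet ht).ddg (.inl i) (.inl i) = 0 := by
  have hq := S.q0 t ht
  have ha := hρ t ht
  have h1 : jetRicci (S.jet ht).Gi (S.jet ht).dGi (S.jet ht).dg (S.jet ht).ddg (.inl i) (.inl i)
      = rho H i t * (pd i q t / q t - scalarRhs H i t) := by
    have h2 : ((S.jet ht).K * (S.jet ht).dH i * (S.jet ht).K * (S.jet ht).dH i).trace
        = quadTrace H i i t := by
      rw [Matrix.mul_assoc ((S.jet ht).K * (S.jet ht).dH i)]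
      rfl
    have h3 : ((S.jet ht).K * (S.jet ht).dH i).trace = 2 * rho H i t := by
      rw [rho]; simp [jet]; ring
    have h4 : ((S.jet ht).K * (S.jet ht).ddH i i).trace
        = 2 * pd i (rho H i) t + quadTrace H i i t := by
      rw [S.pd_rho ht]; simp [jet]; ring
    rw [KillingJet.jetRicci_inl_self, S.scalarRhs_eq ht hρ, h2, h3, h4]
    change pd i q t / q t * _ / 2 - _ + _ = _
    field_simp
    ring
  rw [h1, ScalarEq, S.pd_log_q ht, ← sub_eq_zero]
  simp [ha]

/-- The twist equation gives `w = (q/r) A`, which turns the term quadratic in `w` into the source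
built from `A`. -/
theorem matrixEq_iff_jetRicci (ht : t ∈ U) (hT : TwistEq H F q A t) : MatrixEq Λ H q A t ↔
    ∀ k l, jetRicci (S.jet ht).Gi (S.jet ht).dGi (S.jet ht).dg (S.jet ht).ddg (.inr k) (.inr l)
      = Λ * H t k l := by
  have hq := S.q0 t ht
  have hr := (S.rad_pos ht).ne'
  have hw : ∀ k, (S.jet ht).w k = q t / rad H t * A k := fun k =>
    congrFun ((S.twistEq_iff ht).1 hT) k
  -- The index order `1, 0` makes the mixed derivative of `H` literally the entry `ddH 0 1` of the
  -- jet.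
  rw [S.matrixEq_iff ht one_ne_zero, ← Matrix.ext_iff]
  refine forall_congr' fun k => forall_congr' fun l => ?_
  have h1 : jetRicci (S.jet ht).Gi (S.jet ht).dGi (S.jet ht).dg (S.jet ht).ddg (.inr k) (.inr l)
      = Λ * H t k l - 1 / (2 * q t) * loweredResidual Λ H q A 1 0 t k l := by
    rw [KillingJet.jetRicci_inr_inr, hw, hw]
    have h3 : ∀ i, ((S.jet ht).K * (S.jet ht).dH i).trace = 2 * rho H i t := fun i => by
      rw [rho]; simp [jet]; ring
    rw [h3, h3, loweredResidual]
    simp only [Matrix.add_apply, Matrix.sub_apply, Matrix.smul_apply, smul_eq_mul,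
      Matrix.vecMulVec_apply]
    change -(1 / (2 * q t)) * (2 * matPd 0 (matPd 1 H) t k l
      - (matPd 0 H t * (H t)⁻¹ * matPd 1 H t) k l - (matPd 1 H t * (H t)⁻¹ * matPd 0 H t) k l
      + _ * matPd 0 H t k l + _ * matPd 1 H t k l) - 1 / (2 * q t ^ 2) * _ = _
    field_simp
    ring
  rw [h1]
  simp [hq]

/-- This Einstein equation is not independent: the system determines `(ln q)_{,12}`, and its value
cancels everything in the component except `Λq`. -/
theorem jetRicci_mixed_of_system (hρ : ∀ i, ∀ s ∈ U, rho H i s ≠ 0)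
    (h : ReducedSystem Λ H F q A U) (ht : t ∈ U) (hij : i ≠ j) :
    jetRicci (S.jet ht).Gi (S.jet ht).dGi (S.jet ht).dg (S.jet ht).ddg (.inl i) (.inl j)
      = Λ * q t := by
  have hq := S.q0 t ht
  have hr := (S.rad_pos ht).ne'
  have hw : ∀ k, (S.jet ht).w k = q t / rad H t * A k := fun k =>
    congrFun ((S.twistEq_iff ht).1 (h t ht).2.2.2) k
  have hf : ∀ k, (S.jet ht).dF 1 0 k - (S.jet ht).dF 0 1 k
      = q t / rad H t * (A ᵥ* (H t)⁻¹) k := fun k => congrFun (h t ht).2.2.2 k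
  have hres : matPd 0 (matrixResidual Λ H q A) t = 0 := by
    rw [matPd_congr_on S.hU (B := fun _ => 0) (fun s hs => ?_) ht, matPd_const]
    rw [S.matrixResidual_eq hs zero_ne_one, (S.matrixEq_iff hs zero_ne_one).1 (h s hs).1,
      Matrix.zero_mul, smul_zero]
  have h1 := S.pd_scalarRhs ht zero_ne_one (hρ 0) (h t ht).1 hres (h t ht).2.1
  have h2 : pd 1 (scalarRhs H 0) t = pd 1 (pd 0 q) t / q t - pd 0 q t * pd 1 q t / q t ^ 2 := by
    have e1 := (contDiffOn_pd S.hU S.sq 0).dAt S.hU ht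
    have e2 := S.sq.dAt S.hU ht
    rw [pd_congr_on S.hU (g := fun s => pd 0 q s / q s)
      (fun s hs => (h s hs).2.1.symm.trans (S.pd_log_q hs 0)) ht, pd_div e1 e2 hq]
    field_simp
  have h3 : ((S.jet ht).K * (S.jet ht).dH 0 * (S.jet ht).K * (S.jet ht).dH 1).trace
      = quadTrace H 0 1 t := by
    rw [Matrix.mul_assoc ((S.jet ht).K * (S.jet ht).dH 0)]
    rfl
  have h4 : ((S.jet ht).K * (S.jet ht).ddH 0 1).trace
      = 2 * pd 1 (rho H 0) t + quadTrace H 0 1 t := by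
    rw [S.pd_rho_comm ht, S.pd_rho ht]; simp [jet]; ring
  have h5 : ∑ k, A k * (A ᵥ* (H t)⁻¹) k = twistNorm H A t := by
    rw [twistNorm_eq, Matrix.dotProduct_mulVec]
    exact dotProduct_comm _ _
  have h6 : ∑ k, (S.jet ht).w k * ((S.jet ht).dF 1 0 k - (S.jet ht).dF 0 1 k)
      = (q t / rad H t) ^ 2 * twistNorm H A t := by
    rw [← h5, Finset.mul_sum]
    exact Finset.sum_congr rfl fun k _ => by rw [hw, hf]; ring
  rw [KillingJet.jetRicci_inl_of_ne _ hij, h3, h4, h6]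
  change -(pd 0 (pd 1 q) t / q t - pd 0 q t * pd 1 q t / q t ^ 2) - _ + _ + _ / (2 * q t) = _
  rw [pd_comm S.hU S.sq ht, ← h2, h1]
  field_simp
  ring

/-- The Einstein equations are equivalent to the reduced system. -/
theorem isLambdaVacuum_iff (hUc : IsConnected U) (hρ : ∀ i, ∀ s ∈ U, rho H i s ≠ 0) :
    IsLambdaVacuum Λ (metric (nullForm q) H F) {x | proj x ∈ U}
      ↔ ∃ A : Fin 2 → ℝ, ReducedSystem Λ H F q A U := by
  constructor
  · intro h
    have h1 : ∀ t (ht : t ∈ U) (μ ν : Fin 2 ⊕ Fin 2), jetRicci (S.jet ht).Gi (S.jet ht).dGi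
        (S.jet ht).dg (S.jet ht).ddg μ ν = Λ * Matrix.fromBlocks (offDiag (q t)) 0 0 (H t) μ ν :=
      -- Nothing depends on `z`, so one point of each fibre, here `z = 0`, carries all the
      -- information.
      fun t ht => (S.einstein_iff (x := Sum.elim t 0) Λ ht).1 (h (Sum.elim t 0) ht)
    obtain ⟨A, hA⟩ := (S.exists_twistEq_iff hUc).2 fun t ht e k => by
      have h2 := h1 t ht (.inr k) (.inl e)
      have hq : (S.jet ht).q ≠ 0 := S.q0 t ht
      rw [KillingJet.jetRicci_inr_inl] at h2
      fin_cases e <;> simpa [hq] using h2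
    refine ⟨A, fun t ht => ⟨(S.matrixEq_iff_jetRicci ht (hA t ht)).2 fun k l => h1 t ht _ _,
      (S.scalarEq_iff ht (hρ 0)).2 ?_, (S.scalarEq_iff ht (hρ 1)).2 ?_, hA t ht⟩⟩
    · simpa using h1 t ht (.inl 0) (.inl 0)
    · simpa using h1 t ht (.inl 1) (.inl 1)
  · rintro ⟨A, hA⟩ x hx
    have hx' : proj x ∈ U := hx
    rw [S.einstein_iff Λ hx']
    have hdw := (S.exists_twistEq_iff hUc).1 ⟨A, fun t ht => (hA t ht).2.2.2⟩ _ hx'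
    have h0 := (S.scalarEq_iff hx' (hρ 0)).1 (hA _ hx').2.1
    have h1 := (S.scalarEq_iff hx' (hρ 1)).1 (hA _ hx').2.2.1
    rintro (i | i) (j | j)
    · by_cases hij : i = j
      · subst hij
        fin_cases i
        · simpa using h0
        · simpa using h1
      · rw [S.jetRicci_mixed_of_system hρ hA hx' hij]
        fin_cases i <;> fin_cases j <;> first | exact absurd rfl hij | rfl
    · rw [KillingJet.jetRicci_inl_inr, hdw]; simp
    · rw [KillingJet.jetRicci_inr_inl, hdw]; simp
    · exact (S.matrixEq_iff_jetRicci hx' (hA _ hx').2.2.2).1 (hA _ hx').1 i j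

end Setup

end G2Metric

/-! ### Integrability of the distribution orthogonal to the Killing leaves. -/

namespace G2Metric

namespace Setup

variable {U : Set (Fin 2 → ℝ)} {H F : (Fin 2 → ℝ) → Matrix (Fin 2) (Fin 2) ℝ}
    {q : (Fin 2 → ℝ) → ℝ} (S : Setup U H F q) {t : Fin 2 → ℝ} {Λ : ℝ} {A : Fin 2 → ℝ}
    {x : Fin 2 ⊕ Fin 2 → ℝ}
include S

/-- Pairing `v` with the Killing vectors gives `H` applied to the values of `dz^k + f_i^k dt^i` on
`v`, and `H` is invertible. -/
theorem mem_orthDistribution_iff (hx : proj x ∈ U) (v : Fin 2 ⊕ Fin 2 → ℝ) :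
    v ∈ orthDistribution (metric (nullForm q) H F) x
      ↔ ∀ k, v (.inr k) + ∑ i, F (proj x) i k * v (.inl i) = 0 := by
  set c : Fin 2 → ℝ := fun k => v (.inr k) + ∑ i, F (proj x) i k * v (.inl i) with hc
  have h1 : v ∈ orthDistribution (metric (nullForm q) H F) x
      ↔ ∀ k, (metric (nullForm q) H F x *ᵥ v) (.inr k) = 0 := by
    rw [orthDistribution, LinearMap.BilinForm.mem_orthogonal_iff, killingSpan]
    constructor
    · intro h k
      have := h _ (Submodule.subset_span ⟨k, rfl⟩)
      rwa [Matrix.toBilin'_apply', single_one_dotProduct] at this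
    · intro h n hn
      induction hn using Submodule.span_induction with
      | mem n hn =>
        obtain ⟨k, rfl⟩ := hn
        rw [Matrix.toBilin'_apply', single_one_dotProduct, h]
      | zero => simp
      | add a b _ _ ha hb => rw [map_add, LinearMap.add_apply, ha, hb, add_zero]
      | smul r a _ ha => rw [map_smul, LinearMap.smul_apply, ha, smul_zero]
  have h2 : ∀ k, (metric (nullForm q) H F x *ᵥ v) (.inr k) = (H (proj x) *ᵥ c) k := by
    intro k
    have hs : H (proj x) 1 0 = H (proj x) 0 1 := (S.symm _ hx).apply 0 1
    simp only [metric, Matrix.mulVec, dotProduct, Fintype.sum_sum_type, Matrix.fromBlocks_apply₂₁,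
      Matrix.fromBlocks_apply₂₂, Matrix.transpose_apply, Matrix.mul_apply, hc, Fin.sum_univ_two]
    fin_cases k <;> simp only [Fin.zero_eta, Fin.mk_one, hs] <;> ring
  have h3 : (∀ k, (H (proj x) *ᵥ c) k = 0) ↔ c = 0 := by
    constructor
    · intro h
      have h4 : H (proj x) *ᵥ c = 0 := funext h
      rw [← Matrix.one_mulVec c, ← S.inv_mul hx, ← Matrix.mulVec_mulVec, h4, Matrix.mulVec_zero]
    · intro h k
      rw [h, Matrix.mulVec_zero, Pi.zero_apply]
  rw [h1]
  simp only [h2]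
  rw [h3, funext_iff]
  rfl

/-- A closed twist form has local primitives. -/
theorem exists_primitive (hF : ∀ t ∈ U, ∀ k, matPd 1 F t 0 k = matPd 0 F t 1 k) {ε : ℝ}
    (hε : Metric.ball t ε ⊆ U) (k : Fin 2) : ∃ φ : (Fin 2 → ℝ) → ℝ,
      ContDiffOn ℝ ∞ φ (Metric.ball t ε) ∧ ∀ s ∈ Metric.ball t ε, ∀ v,
        fderiv ℝ φ s v = ∑ i, F s i k * v i := by
  set η : (Fin 2 → ℝ) → (Fin 2 → ℝ) →L[ℝ] ℝ := fun s =>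
    ∑ i, F s i k • (ContinuousLinearMap.proj i : (Fin 2 → ℝ) →L[ℝ] ℝ) with hη
  have hB : IsOpen (Metric.ball t ε) := Metric.isOpen_ball
  have hs : ContDiffOn ℝ ∞ η (Metric.ball t ε) :=
    ContDiffOn.sum fun i _ => ((S.sF i k).mono hε).smul contDiffOn_const
  have hdη : ∀ a ∈ Metric.ball t ε, ∀ x y, fderiv ℝ η a x y
      = ∑ i, (∑ j, x j * matPd j F a i k) * y i := by
    intro a ha x y
    have hd : ∀ i, DifferentiableAt ℝ (fun s => F s i k) a := fun i => (S.sF i k).dAt S.hU (hε ha)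
    have h1 : HasFDerivAt η (∑ i, (fderiv ℝ (fun s => F s i k) a).smulRight
        (ContinuousLinearMap.proj i : (Fin 2 → ℝ) →L[ℝ] ℝ)) a :=
      HasFDerivAt.fun_sum fun i _ => 
        (hd i).hasFDerivAt.smul_const (ContinuousLinearMap.proj i : (Fin 2 → ℝ) →L[ℝ] ℝ)
    rw [h1.fderiv]
    simp [fderiv_eq_sum_pd, matPd]
  -- Poincaré lemma on a convex ball: closedness of the form is symmetry of its derivative.
  obtain ⟨φ, hφ⟩ := (convex_ball t ε).exists_forall_hasFDerivAt_of_fderiv_symmetric hB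
    (hs.differentiableOn (by simp)) fun a ha x y => by
      rw [hdη a ha, hdη a ha]
      simp only [Fin.sum_univ_two, hF a (hε ha)]
      ring
  refine ⟨φ, ?_, fun s hs v => ?_⟩
  · rw [contDiffOn_infty_iff_fderiv_of_isOpen hB]
    exact ⟨fun a ha => (hφ a ha).differentiableAt.differentiableWithinAt,
      hs.congr fun a ha => (hφ a ha).fderiv⟩
  · rw [(hφ s hs).fderiv]
    simp [hη]

/-- With local primitives `φ k` of the twist forms, the functions `z^k + φ^k(t)` have differentials
`dz^k + f_i^k dt^i`, whose common kernel is the distribution. -/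
theorem isCompletelyIntegrable_of_closed
    (hF : ∀ t ∈ U, ∀ k, matPd 1 F t 0 k = matPd 0 F t 1 k) :
    IsCompletelyIntegrable {x | proj x ∈ U} (orthDistribution (metric (nullForm q) H F)) := by
  intro p hp
  obtain ⟨ε, hε, hball⟩ := Metric.isOpen_iff.1 S.hU _ hp
  choose φ hφ hdφ using fun k => S.exists_primitive hF hball k
  have hV := isOpen_proj_preimage (Metric.isOpen_ball (x := proj p) (ε := ε))
  refine ⟨{x | proj x ∈ Metric.ball (proj p) ε}, hV, Metric.mem_ball_self hε,
    fun x hx => hball hx, 2, fun x k => x (.inr k) + φ k (proj x), ?_, fun x hx => ?_⟩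
  · exact contDiffOn_pi.2 fun k =>
      (contDiff_apply ℝ ℝ (Sum.inr k)).contDiffOn.add (contDiffOn_comp_proj (hφ k))
  have hd : ∀ v k, fderiv ℝ (fun x k => x (.inr k) + φ k (proj x)) x v k
      = v (.inr k) + ∑ i, F (proj x) i k * v (.inl i) := by
    intro v k
    have h1 : ∀ k, HasFDerivAt (fun x : Fin 2 ⊕ Fin 2 → ℝ => x (.inr k) + φ k (proj x))
        (ContinuousLinearMap.proj (Sum.inr k) + (fderiv ℝ (φ k) (proj x)).comp projL) x := fun k =>
      (hasFDerivAt_apply (Sum.inr k) x).add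
        (((hφ k).dAt Metric.isOpen_ball hx).hasFDerivAt.comp x projL.hasFDerivAt)
    rw [(hasFDerivAt_pi.2 h1).fderiv]
    simp [hdφ k _ hx, projL_apply, proj]
  constructor
  · intro c
    -- Vertical vectors alone already give surjectivity.
    refine ⟨Sum.elim 0 c, funext fun k => ?_⟩
    rw [hd]
    simp
  · ext v
    rw [S.mem_orthDistribution_iff (hball hx), LinearMap.mem_ker, funext_iff]
    exact forall_congr' fun k => by rw [← hd]; rfl

/-- The horizontal lifts of `∂/∂t¹` and `∂/∂t²` have a horizontal bracket, hence commute. -/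
theorem closed_of_isCompletelyIntegrable
    (h : IsCompletelyIntegrable {x | proj x ∈ U} (orthDistribution (metric (nullForm q) H F)))
    (ht : t ∈ U) (k : Fin 2) : matPd 1 F t 0 k = matPd 0 F t 1 k := by
  obtain ⟨V, hV, hpV, hVU, m, y, hy, hD⟩ := h (Sum.elim t 0) ht
  set p : Fin 2 ⊕ Fin 2 → ℝ := Sum.elim t 0 with hp
  -- The horizontal lifts `∂/∂t^i - f_i^k ∂/∂z^k`.
  set e : Fin 2 → (Fin 2 ⊕ Fin 2 → ℝ) → (Fin 2 ⊕ Fin 2 → ℝ) := fun i x =>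
    Sum.elim (Pi.single i 1) (fun k => -F (proj x) i k) with he
  have hed : ∀ i, ∀ v, HasFDerivAt (e i) (fderiv ℝ (e i) p) p ∧ fderiv ℝ (e i) p v
      = Sum.elim (0 : Fin 2 → ℝ) (fun k => -∑ j, v (.inl j) * matPd j F t i k) := by
    intro i v
    have h1 : HasFDerivAt (e i) (ContinuousLinearMap.pi fun a =>
        (Sum.elim (fun _ => 0) (fun k => -(fderiv ℝ (fun s => F s i k) t).comp projL) :
          Fin 2 ⊕ Fin 2 → (Fin 2 ⊕ Fin 2 → ℝ) →L[ℝ] ℝ) a) p := by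
      rw [hasFDerivAt_pi]
      rintro (a | a)
      · exact hasFDerivAt_const _ _
      · exact (((S.sF i a).dAt S.hU ht).hasFDerivAt.comp p projL.hasFDerivAt).neg
    refine ⟨h1.differentiableAt.hasFDerivAt, ?_⟩
    rw [h1.fderiv]
    ext (a | a)
    · simp
    · simp [fderiv_eq_sum_pd, projL_apply, proj, matPd]
  have hker : ∀ i, ∀ x ∈ V, fderiv ℝ y x (e i x) = 0 := by
    intro i x hx
    have h1 : e i x ∈ orthDistribution (metric (nullForm q) H F) x := by
      rw [S.mem_orthDistribution_iff (hVU hx)]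
      intro k
      fin_cases i <;> simp [he, Fin.sum_univ_two]
    rw [(hD x hx).2] at h1
    exact h1
  have hyp : ContDiffAt ℝ ∞ y p := hy.contDiffAt (hV.mem_nhds hpV)
  have hs : IsSymmSndFDerivAt ℝ y p := hyp.isSymmSndFDerivAt
    (by rw [minSmoothness_of_isRCLikeNormedField]; exact WithTop.coe_le_coe.2 (le_top : (2 : ℕ∞) ≤ ⊤))
  have hdd : DifferentiableAt ℝ (fderiv ℝ y) p :=
    ((hy.fderiv_of_isOpen hV (m := ∞) (by simp)).contDiffAt
      (hV.mem_nhds hpV)).differentiableAt (by simp)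
  -- The derivative of the identity `dy(e i) = 0`, which holds throughout `V`.
  have hder : ∀ i v, fderiv ℝ (fderiv ℝ y) p v (e i p) + fderiv ℝ y p (fderiv ℝ (e i) p v) = 0 := by
    intro i v
    have h1 : fderiv ℝ (fun x => fderiv ℝ y x (e i x)) p = 0 := by
      have : (fun x => fderiv ℝ y x (e i x)) =ᶠ[𝓝 p] fun _ => 0 :=
        Set.EqOn.eventuallyEq_of_mem (hker i) (hV.mem_nhds hpV)
      rw [this.fderiv_eq, fderiv_fun_const, Pi.zero_apply]
    rw [fderiv_clm_apply hdd (hed i v).1.differentiableAt] at h1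
    have h2 := DFunLike.congr_fun h1 v
    simpa [add_comm] using h2
  -- Symmetry of the second derivative of `y` cancels the second-order terms, so the bracket lies in
  -- the kernel of `dy`.
  have hb : fderiv ℝ y p (fderiv ℝ (e 0) p (e 1 p) - fderiv ℝ (e 1) p (e 0 p)) = 0 := by
    have h0 := hder 0 (e 1 p)
    have h1 := hder 1 (e 0 p)
    rw [hs.eq] at h1
    rw [map_sub, eq_neg_of_add_eq_zero_right h0, eq_neg_of_add_eq_zero_right h1, sub_self]
  have hmem : fderiv ℝ (e 0) p (e 1 p) - fderiv ℝ (e 1) p (e 0 p)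
      ∈ orthDistribution (metric (nullForm q) H F) p := by
    rw [(hD p hpV).2]
    exact hb
  rw [S.mem_orthDistribution_iff (by exact ht)] at hmem
  -- The bracket has no `t`-components, so membership in the distribution forces its `z`-components
  -- to vanish; these are the components of `F_{1,2} - F_{2,1}` up to sign.
  have h1 := hmem k
  rw [(hed 0 _).2, (hed 1 _).2] at h1
  simp [he, Fin.sum_univ_two] at h1
  linarith

/-- Since `A` is constant and `q / r` never vanishes, closedness of the twist form at one point
already gives `A = 0`. -/
theorem eq_zero_iff_isCompletelyIntegrable (hne : U.Nonempty) (h : ReducedSystem Λ H F q A U) :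
    A = 0 ↔ IsCompletelyIntegrable {x | proj x ∈ U}
      (orthDistribution (metric (nullForm q) H F)) := by
  constructor
  · rintro rfl
    refine S.isCompletelyIntegrable_of_closed fun t ht k => ?_
    have h1 := congrFun (h t ht).2.2.2 k
    rw [Matrix.zero_vecMul, smul_zero] at h1
    exact sub_eq_zero.1 h1
  · intro hI
    obtain ⟨t, ht⟩ := hne
    have h1 := (S.twistEq_iff ht).1 (h t ht).2.2.2
    have h2 : matPd 1 F t 0 - matPd 0 F t 1 = 0 :=
      funext fun k => sub_eq_zero.2 (S.closed_of_isCompletelyIntegrable hI ht k)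
    rw [loweredTwist, h2, Matrix.zero_vecMul] at h1
    exact (smul_eq_zero.1 h1.symm).resolve_left (div_ne_zero (S.q0 t ht) (S.rad_pos ht).ne')

end Setup

end G2Metric

theorem mainTheorem10 (Λ : ℝ) (U : Set (Fin 2 → ℝ)) (hU : IsOpen U) (hUc : IsConnected U)
    (H F : (Fin 2 → ℝ) → Matrix (Fin 2) (Fin 2) ℝ) (q : (Fin 2 → ℝ) → ℝ)
    (hH : ∀ k l, ContDiffOn ℝ ∞ (fun t => H t k l) U)
    (hF : ∀ i k, ContDiffOn ℝ ∞ (fun t => F t i k) U)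
    (hq : ContDiffOn ℝ ∞ q U)
    (hHsymm : ∀ t ∈ U, (H t).IsSymm)
    (hHdet : ∀ t ∈ U, 0 < (H t).det)
    (hq0 : ∀ t ∈ U, q t ≠ 0)
    (hC : ∀ t ∈ U, G2Metric.cRho (G2Metric.nullForm q) H t ≠ 0) :
    (G2Metric.IsLambdaVacuum Λ (G2Metric.metric (G2Metric.nullForm q) H F)
        {x | G2Metric.proj x ∈ U} ↔
      ∃ A : Fin 2 → ℝ, G2Metric.ReducedSystem Λ H F q A U) ∧
    (∀ A : Fin 2 → ℝ, G2Metric.ReducedSystem Λ H F q A U →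
      (A = 0 ↔ G2Metric.IsCompletelyIntegrable {x | G2Metric.proj x ∈ U}
        (G2Metric.orthDistribution (G2Metric.metric (G2Metric.nullForm q) H F)))) ∧
    (∀ A : Fin 2 → ℝ, ∀ t ∈ U, G2Metric.CompatibleAt Λ H q A t) ∧
    (∀ A : Fin 2 → ℝ, ∀ t ∈ U, G2Metric.MatrixEq Λ H q A t →
      G2Metric.pd 1 (G2Metric.pd 0 (G2Metric.rad H)) t
        = -Λ * q t * G2Metric.rad H t
          - q t / (4 * G2Metric.rad H t) * (A ⬝ᵥ ((H t)⁻¹ *ᵥ A))) := by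
  have S : G2Metric.Setup U H F q := ⟨hU, hH, hF, hq, hHsymm, hHdet, hq0⟩
  have hρ : ∀ i, ∀ s ∈ U, G2Metric.rho H i s ≠ 0 := fun i s hs => S.rho_ne_zero (hC s hs) hs i
  exact ⟨S.isLambdaVacuum_iff hUc hρ,
    fun A hA => S.eq_zero_iff_isCompletelyIntegrable hUc.nonempty hA,
    fun A t ht => S.compatibleAt ht hρ, fun A t ht h => S.pd_pd_rad ht h⟩
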